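/- Let $G$ be a finite connected metric graph with vertex set $\mathcal V$ and edges $I_j$; each edge is parametrized by arc length by $\sigma_j:I_j\to[0,s_j]$, $s_j>0$, its two ends are distinct vertices, and $G$ carries its path distance. A Lagrangian $L$ on $G$ consists of $C^2$ functions $L_j:I_j\times\mathbb R\to\mathbb R$ such that $L_j(x,\cdot)$ is strictly convex and superlinear for every $x\in I_j$ and $L_i(e,0)=L_j(e,0)$ whenever the vertex $e$ lies in $I_i\cap I_j$. It is symmetric at the vertices if for every vertex $e$ there is $\lambda_e:[0,\infty)\to\mathbb R$ with $L_j(e,z)=\lambda_e(|z|)$ for all $z\in\mathbb R$ and all $j$ with $e\in I_j$. For $t>0$ let $h_t(x,y)$ be the minimum of $\int_0^tL(\gamma,\dot\gamma)\,ds$ over absolutely continuous $\gamma:[0,t]\to G$ with $\gamma(0)=x$, $\gamma(t)=y$ (with $\dot\gamma=0$ at almost every time spent at vertices). Let $c$ be the critical value of $L$: the real number such that $\liminf_{t\to\infty}\,(h_t(x,y)+kt)$ is $+\infty$ for all $x,y\in G$ if $k>c$, is $-\infty$ for all $x,y$ if $k<c$, and is finite for all $x,y$ if $k=c$. The Lax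 semigroup is $\mathcal L_tf(x)=\inf_{y\in G}\,\bigl(f(y)+h_t(y,x)\bigr)$, $t>0$. For $x\in I_j$ and $p\in\mathbb R$ put $$H_j(x,p)=\max_z\{-pz-L_j(x,-z)\},$$ where $z$ ranges over $\mathbb R$ if $x$ is not a vertex (so that $H_j(x,p)=\max_v\{pv-L_j(x,v)\}$), and over the vectors that are zero or point into $I_j$ if $x$ is a vertex (that is, $z\ge 0$ if $\sigma_j(x)=0$ and $z\le 0$ if $\sigma_j(x)=s_j$). A function defined near $x\in G$ is $C^1$ if its restriction to each edge $I_j$ containing $x$ is $C^1$ up to the ends of the edge; its derivative along $I_j$ in the coordinate $\sigma_j$ is denoted $D^j$. A continuous $f:G\to\mathbb R$ is a viscosity solution of $$H(x,Df(x))=c$$ if for every $x\in G$ and every $C^1$ function $\varphi$ near $x$: if $f-\varphi$ has a local maximum at $x$, then $\max\{H_j(x,D^j\varphi(x)):x\in I_j\}\le c$; and if $f-\varphi$ has a local minimum at $x$, then $\max\{H_j(x,D^j\varphi(x)):x\in I_j\}\ge c$. Suppose that $L$ is symmetric at the vertices and let $f:G\to\mathbb R$ be a viscosity solution of $H(x,Df(x))=c$.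 Then $f$ is a fixed point of $\mathcal L_t+ct$, that is, $$\mathcal L_tf(x)+ct=f(x)\qquad\text{for all }t>0,\ x\in G.$$ Consequently $f$ is a backward weak KAM solution: $f$ is continuous, $f(y)-f(x)\le h_t(x,y)+ct$ for all $x,y\in G$ and $t>0$, and for every $x\in G$ there is a curve $\gamma:(-\infty,0]\to G$, absolutely continuous on compact intervals, with $\gamma(0)=x$ and $f(\gamma(t))-f(\gamma(s))=\int_s^tL(\gamma,\dot\gamma)\,d\tau+c(t-s)$ for all $s\le t\le 0$. -/

import Mathlib

open Set Filter Topology MeasureTheory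

/-- A finite connected metric graph with vertex set `V` and edge set `E`.  The edge `j` is a segment
of length `len j`, parametrized by arc length by `[0, len j]`, going from the vertex `src j` to the
vertex `tgt j`.  Several edges may join the same two vertices; an edge is embedded, so its two ends
are distinct.  (Finiteness of `V` and `E` is a hypothesis of the theorem.) -/
structure MetricGraph (V E : Type*) where
  src : E → V
  tgt : E → V
  len : E → ℝ
  len_pos : ∀ j, 0 < len j
  src_ne_tgt : ∀ j, src j ≠ tgt j
  connected : ∀ v w : V, Relation.EqvGen (fun a b => ∃ j, src j = a ∧ tgt j = b) v w

namespace MetricGraph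

variable {V E : Type*}

/-- The points of the graph: the vertices, and the points in the interior of the edges. -/
inductive Point (Γ : MetricGraph V E) : Type _
  | vertex (v : V) : Point Γ
  | interior (j : E) (x : Ioo (0 : ℝ) (Γ.len j)) : Point Γ

open scoped Classical in
/-- The arc length parametrization `[0, len j] → G` of the edge `j` (extended to `ℝ` by the
end points of the edge). -/
noncomputable def param (Γ : MetricGraph V E) (j : E) (a : ℝ) : Γ.Point :=
  if h : a ∈ Ioo (0 : ℝ) (Γ.len j) then .interior j ⟨a, h⟩
  else if a ≤ 0 then .vertex (Γ.src j) else .vertex (Γ.tgt j)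

open scoped Classical in
/-- The inverse of the parametrization, `I_j → [0, len j]`; the value off the edge `j` is
irrelevant and set to `0`. -/
noncomputable def coord (Γ : MetricGraph V E) (j : E) : Γ.Point → ℝ
  | .vertex v => if v = Γ.tgt j then Γ.len j else 0
  | .interior i x => if i = j then (x : ℝ) else 0

/-- `Γ.Chain x y ℓ`: there is a path of length `ℓ` from `x` to `y` which is a finite
concatenation of segments, each contained in one edge. -/
inductive Chain (Γ : MetricGraph V E) : Γ.Point → Γ.Point → ℝ → Prop
  | refl (x : Γ.Point) : Chain Γ x x 0
  | cons (j : E) (a b : ℝ) (ha : a ∈ Icc 0 (Γ.len j)) (hb : b ∈ Icc 0 (Γ.len j))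
      (y : Γ.Point) (ℓ : ℝ) (h : Chain Γ (Γ.param j b) y ℓ) :
      Chain Γ (Γ.param j a) y (|a - b| + ℓ)

/-- The path distance of the graph. -/
noncomputable def pathDist (Γ : MetricGraph V E) (x y : Γ.Point) : ℝ :=
  sInf {ℓ : ℝ | Γ.Chain x y ℓ}

section Distance

variable {Γ : MetricGraph V E}

lemma Chain.nonneg {x y : Γ.Point} {ℓ : ℝ} (h : Γ.Chain x y ℓ) : 0 ≤ ℓ := by
  induction h with
  | refl => exact le_rfl
  | cons j a b ha hb y ℓ h ih => positivity

lemma Chain.append {x y z : Γ.Point} {ℓ m : ℝ} (h : Γ.Chain x y ℓ) (h' : Γ.Chain y z m) :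
    Γ.Chain x z (ℓ + m) := by
  induction h with
  | refl => simpa using h'
  | cons j a b ha hb y ℓ h ih =>
    rw [add_assoc]
    exact Chain.cons j a b ha hb z _ (ih h')

lemma Chain.segment (j : E) {a b : ℝ} (ha : a ∈ Icc 0 (Γ.len j)) (hb : b ∈ Icc 0 (Γ.len j)) :
    Γ.Chain (Γ.param j a) (Γ.param j b) |a - b| := by
  simpa using Chain.cons j a b ha hb _ 0 (Chain.refl _)

lemma Chain.symm {x y : Γ.Point} {ℓ : ℝ} (h : Γ.Chain x y ℓ) : Γ.Chain y x ℓ := by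
  induction h with
  | refl => exact Chain.refl _
  | cons j a b ha hb y ℓ h ih =>
    rw [add_comm, abs_sub_comm]
    exact ih.append (Chain.segment j hb ha)

lemma param_zero (Γ : MetricGraph V E) (j : E) : Γ.param j 0 = .vertex (Γ.src j) := by
  simp [param]

lemma param_len (Γ : MetricGraph V E) (j : E) :
    Γ.param j (Γ.len j) = .vertex (Γ.tgt j) := by
  simp [param, Γ.len_pos j]

lemma param_interior (Γ : MetricGraph V E) (j : E) (x : Ioo (0 : ℝ) (Γ.len j)) :
    Γ.param j x = .interior j x := by
  have h : (x : ℝ) ∈ Ioo (0 : ℝ) (Γ.len j) := x.2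
  simp only [param, dif_pos h]

lemma exists_chain_vertex (v w : V) : ∃ ℓ, Γ.Chain (.vertex v) (.vertex w) ℓ := by
  induction Γ.connected v w with
  | rel a b h =>
    obtain ⟨j, rfl, rfl⟩ := h
    have hl := (Γ.len_pos j).le
    have := Chain.segment (Γ := Γ) j (a := 0) (b := Γ.len j) ⟨le_rfl, hl⟩ ⟨hl, le_rfl⟩
    rw [param_zero, param_len] at this
    exact ⟨_, this⟩
  | refl a => exact ⟨0, Chain.refl _⟩
  | symm a b _ ih => exact ih.imp fun _ h => h.symm
  | trans a b c _ _ ih ih' =>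
    obtain ⟨ℓ, h⟩ := ih
    obtain ⟨m, h'⟩ := ih'
    exact ⟨_, h.append h'⟩

lemma exists_chain_to_vertex (x : Γ.Point) : ∃ v ℓ, Γ.Chain x (.vertex v) ℓ := by
  cases x with
  | vertex v => exact ⟨v, 0, Chain.refl _⟩
  | interior j x =>
    have := Chain.segment (Γ := Γ) j (a := (x : ℝ)) (b := 0) ⟨x.2.1.le, x.2.2.le⟩
      ⟨le_rfl, (Γ.len_pos j).le⟩
    rw [param_zero, param_interior] at this
    exact ⟨_, _, this⟩

lemma exists_chain (x y : Γ.Point) : ∃ ℓ, Γ.Chain x y ℓ := by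
  obtain ⟨v, ℓ, h⟩ := exists_chain_to_vertex x
  obtain ⟨w, m, h'⟩ := exists_chain_to_vertex y
  obtain ⟨n, h''⟩ := exists_chain_vertex (Γ := Γ) v w
  exact ⟨_, (h.append h'').append h'.symm⟩

lemma pathDist_bddBelow (x y : Γ.Point) : BddBelow {ℓ : ℝ | Γ.Chain x y ℓ} :=
  ⟨0, fun _ h => Chain.nonneg h⟩

end Distance

/-- The path distance on the graph (points at distance `0` coincide, since edges have positive
length and `V`, `E` are finite); its topology is the one used below. -/
noncomputable instance (Γ : MetricGraph V E) : PseudoMetricSpace Γ.Point where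
  dist x y := Γ.pathDist x y
  dist_self x := le_antisymm (csInf_le (pathDist_bddBelow x x) (Chain.refl x))
    (le_csInf (exists_chain x x) fun _ h => Chain.nonneg h)
  dist_comm x y := by
    have : {ℓ : ℝ | Γ.Chain x y ℓ} = {ℓ : ℝ | Γ.Chain y x ℓ} :=
      Set.ext fun ℓ => ⟨Chain.symm, Chain.symm⟩
    simp only [pathDist, this]
  dist_triangle x y z := by
    refine le_of_forall_pos_le_add fun ε hε => ?_
    obtain ⟨ℓ, h, hl⟩ := Real.lt_sInf_add_pos (exists_chain x y) (half_pos hε)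
    obtain ⟨m, h', hm⟩ := Real.lt_sInf_add_pos (exists_chain y z) (half_pos hε)
    have := csInf_le (pathDist_bddBelow x z) (Chain.append h h')
    have hl' : ℓ < Γ.pathDist x y + ε / 2 := hl
    have hm' : m < Γ.pathDist y z + ε / 2 := hm
    have hs : Γ.pathDist x z ≤ ℓ + m := this
    linarith

/-- The velocity `γ'(t)` of a curve in the graph, in the arc length coordinate of the edge that
contains `γ t`.  At a vertex it is `0`; for an absolutely continuous curve the metric derivative
vanishes at almost every time spent at the vertices. -/
noncomputable def velocity {Γ : MetricGraph V E} (γ : ℝ → Γ.Point) (t : ℝ) : ℝ :=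
  match γ t with
  | .vertex _ => 0
  | .interior j _ => deriv (fun s => Γ.coord j (γ s)) t

end MetricGraph

/-- A Lagrangian on the graph: for each edge `j` a `C²` function `L_j` on `[0, len j] × ℝ`,
strictly convex and superlinear in the velocity, such that the values `L_j (e, 0)` at a vertex `e`
do not depend on the edge `j` containing `e`; this common value is `atRest e`. -/
structure GraphLagrangian {V E : Type*} (Γ : MetricGraph V E) where
  toFun : E → ℝ → ℝ → ℝ
  atRest : V → ℝ
  contDiffOn : ∀ j, ContDiffOn ℝ 2 (fun q : ℝ × ℝ => toFun j q.1 q.2) (Icc 0 (Γ.len j) ×ˢ univ)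
  strictConvexOn : ∀ j, ∀ x ∈ Icc 0 (Γ.len j), StrictConvexOn ℝ univ (toFun j x)
  superlinear : ∀ j, ∀ x ∈ Icc 0 (Γ.len j),
    Tendsto (fun v => toFun j x v / |v|) (cocompact ℝ) atTop
  atRest_eq : ∀ j, ∀ x ∈ Icc 0 (Γ.len j), ∀ e, Γ.param j x = .vertex e → toFun j x 0 = atRest e

namespace GraphLagrangian

open MetricGraph

variable {V E : Type*} {Γ : MetricGraph V E}

/-- At each vertex `e` there is a function `lam` with `L_j (e, z) = lam |z|` for every edge `j`
containing `e`. -/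
def SymmetricAtVertices (L : GraphLagrangian Γ) : Prop :=
  ∀ e : V, ∃ lam : ℝ → ℝ, ∀ j, ∀ x ∈ Icc 0 (Γ.len j), Γ.param j x = .vertex e →
    ∀ z, L.toFun j x z = lam |z|

/-- The Lagrangian as a function on the tangent bundle of the graph. -/
def eval (L : GraphLagrangian Γ) : Γ.Point → ℝ → ℝ
  | .vertex e, _ => L.atRest e
  | .interior j x, v => L.toFun j x v

/-- The integrand `L (γ t, γ' t)` of the action. -/
noncomputable def along (L : GraphLagrangian Γ) (γ : ℝ → Γ.Point) (t : ℝ) : ℝ :=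
  L.eval (γ t) (velocity γ t)

/-- `γ` is absolutely continuous on `[a, b]` and has finite action there.  The integrand is bounded
below along every absolutely continuous curve, so its integral is finite exactly when it is
integrable. -/
def FiniteAction (L : GraphLagrangian Γ) (γ : ℝ → Γ.Point) (a b : ℝ) : Prop :=
  AbsolutelyContinuousOnInterval γ a b ∧ IntervalIntegrable (L.along γ) volume a b

/-- The action of `γ` on `[a, b]`. -/
noncomputable def action (L : GraphLagrangian Γ) (γ : ℝ → Γ.Point) (a b : ℝ) : ℝ :=
  ∫ t in a..b, L.along γ t

/-- `h_t (x, y)`: the least action of the absolutely continuous curves `[0, t] → G` from `x`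
to `y`. -/
noncomputable def minAction (L : GraphLagrangian Γ) (t : ℝ) (x y : Γ.Point) : ℝ :=
  sInf {A : ℝ | ∃ γ : ℝ → Γ.Point, L.FiniteAction γ 0 t ∧ γ 0 = x ∧ γ t = y ∧ A = L.action γ 0 t}

/-- `h^k (x, y) = liminf_{t → ∞} (h_t (x, y) + k t)`, an extended real number. -/
noncomputable def barrier (L : GraphLagrangian Γ) (k : ℝ) (x y : Γ.Point) : EReal :=
  liminf (fun t : ℝ => ((L.minAction t x y + k * t : ℝ) : EReal)) atTop

/-- The critical value: the threshold `c` such that `h^k` is identically `∞` for `k > c`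
(for `k < c` it is identically `-∞`, and `h^c` is finite). -/
noncomputable def criticalValue (L : GraphLagrangian Γ) : ℝ :=
  sInf {k : ℝ | ∀ x y, L.barrier k x y = ⊤}

/-- The Lax-Oleinik semigroup `ℒ_t f (x) = inf_y (f y + h_t (y, x))`. -/
noncomputable def lax (L : GraphLagrangian Γ) (t : ℝ) (f : Γ.Point → ℝ) (x : Γ.Point) : ℝ :=
  ⨅ y, (f y + L.minAction t y x)

/-- `u (y) - u (x) ≤ h_t (x, y) + c t` for all points `x`, `y` and all `t > 0`. -/
def Dominated (L : GraphLagrangian Γ) (c : ℝ) (u : Γ.Point → ℝ) : Prop :=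
  ∀ x y, ∀ t > 0, u y - u x ≤ L.minAction t x y + c * t

/-- The curve `γ : (-∞, 0] → G` calibrates `u`. -/
def CalibratesPast (L : GraphLagrangian Γ) (c : ℝ) (u : Γ.Point → ℝ) (γ : ℝ → Γ.Point) : Prop :=
  ∀ s t, s ≤ t → t ≤ 0 →
    L.FiniteAction γ s t ∧ u (γ t) - u (γ s) = L.action γ s t + c * (t - s)

/-- Backward weak KAM solutions. -/
def IsBackwardWeakKAM (L : GraphLagrangian Γ) (c : ℝ) (u : Γ.Point → ℝ) : Prop :=
  Continuous u ∧ L.Dominated c u ∧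
    ∀ x, ∃ γ : ℝ → Γ.Point, γ 0 = x ∧ L.CalibratesPast c u γ

/-- The tangent vectors `z` at the point `x` of the edge `j` which are admitted in the
Hamiltonian: at an end of the edge those which are zero or point into the edge, elsewhere all. -/
def inward (Γ : MetricGraph V E) (j : E) (x : ℝ) : Set ℝ :=
  {z | (x = 0 → 0 ≤ z) ∧ (x = Γ.len j → z ≤ 0)}

/-- The Hamiltonian `H_j (x, p) = max {-p z - L_j (x, -z) : z admitted at x}`.  The vectors
`-z` are the velocities with which a curve in the edge `j` can arrive at `x`; for `x` in the
interior of the edge this is the Legendre transform `max_v (p v - L_j (x, v))`. -/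
noncomputable def hamiltonian (L : GraphLagrangian Γ) (j : E) (x p : ℝ) : ℝ :=
  sSup ((fun z => -p * z - L.toFun j x (-z)) '' inward Γ j x)

/-- `φ` is `C¹` in a neighbourhood of the point `q`: so is its restriction to every edge
containing `q` (up to the ends of the edge). -/
def C1Near (φ : Γ.Point → ℝ) (q : Γ.Point) : Prop :=
  ∀ j, ∀ x ∈ Icc 0 (Γ.len j), Γ.param j x = q →
    ContDiffWithinAt ℝ 1 (φ ∘ Γ.param j) (Icc 0 (Γ.len j)) x

/-- The derivative `D^j φ` of `φ` along the edge `j` at the point of coordinate `x` (one-sided at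
the ends of the edge). -/
noncomputable def edgeDeriv (φ : Γ.Point → ℝ) (j : E) (x : ℝ) : ℝ :=
  derivWithin (φ ∘ Γ.param j) (Icc 0 (Γ.len j)) x

/-- Viscosity subsolutions of `H (x, Du) = c`: if `φ` is `C¹` near `q` and `u - φ` has a local
maximum at `q`, then the maximum of `H_j (q, D^j φ (q))` over the edges `j` containing `q`
(there is exactly one if `q` is not a vertex) is at most `c`. -/
def IsViscositySubsolution (L : GraphLagrangian Γ) (c : ℝ) (u : Γ.Point → ℝ) : Prop :=
  ∀ (φ : Γ.Point → ℝ) (q : Γ.Point), C1Near φ q → IsLocalMax (fun y => u y - φ y) q →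
    ∀ j, ∀ x ∈ Icc 0 (Γ.len j), Γ.param j x = q → L.hamiltonian j x (edgeDeriv φ j x) ≤ c

/-- Viscosity supersolutions of `H (x, Du) = c`: if `φ` is `C¹` near `q` and `u - φ` has a local
minimum at `q`, then the maximum of `H_j (q, D^j φ (q))` over the edges `j` containing `q`
is at least `c`. -/
def IsViscositySupersolution (L : GraphLagrangian Γ) (c : ℝ) (u : Γ.Point → ℝ) : Prop :=
  ∀ (φ : Γ.Point → ℝ) (q : Γ.Point), C1Near φ q → IsLocalMin (fun y => u y - φ y) q →
    ∃ j, ∃ x ∈ Icc 0 (Γ.len j), Γ.param j x = q ∧ c ≤ L.hamiltonian j x (edgeDeriv φ j x)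

/-- Viscosity solutions of `H (x, Du) = c` (continuous, as usual). -/
def IsViscositySolution (L : GraphLagrangian Γ) (c : ℝ) (u : Γ.Point → ℝ) : Prop :=
  Continuous u ∧ L.IsViscositySubsolution c u ∧ L.IsViscositySupersolution c u

end GraphLagrangian

/-!
A viscosity solution `f` of `H (x, Df) = c` is a backward weak KAM solution because the graph is
one-dimensional, so that `f` can be integrated along each edge.

*Slopes.* Testing `f` from above gives `L (x, 0) + c ≥ 0`. Hence on an edge the set of slopes `p`
with `H (x, p) ≤ c` is an interval `[a x, b x]`, depending continuously on `x`, and `p = b x`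
(`p = a x`) satisfies `p v = L (x, v) + c` at a velocity `v = w x ≥ 0` (`v = z x ≤ 0`). The interval
degenerates exactly where `L (x, 0) + c = 0` (`LineLagrangian.exists_criticalSlopes`).

*Domination.* The subsolution property says that `f - ∫ b` is nonincreasing and `f - ∫ a` is
nondecreasing along the edge. As `a v, b v ≤ L (x, v) + c`, the derivative of `f` along an
absolutely continuous curve is at most `L + c` at almost every time inside an edge; at almost every
time spent at a vertex it is zero, and there `L + c ≥ 0`. Integration gives the domination
inequality (`CriticalSolution.sub_le_action`).

*Calibrated curves.* By the supersolution property `f` has no slope strictly between `a` and `b`, so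
between consecutive zeros of `L (x, 0) + c` its slope is `b` up to some point and `a` from there on
(`SegmentSolution.exists_switch`). From a point where the slope is `b` on the left, the solution of
`κ' = w κ` run backwards calibrates `f` until it reaches a zero of `L (x, 0) + c`, where it may rest
forever, or an end of the edge; slope `a` is symmetric. At a vertex `e` where resting is not free,
some edge carries the slope of arriving motions up to `e`. Otherwise `f` would be `C¹` near `e` with
the slopes of departing motions, and `f`, as a test function for itself, would violate the
supersolution inequality at `e`, in which only arriving velocities are admitted
(`IsViscositySolution.exists_criticalSolution`). Crossing an edge takes a time bounded below, so
calibrated curves of unit duration end at every point, and they can be concatenated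
(`CriticalSolution.exists_calibratesPast`). Together with domination this gives both the fixed point
property and the weak KAM property.

The speed `w` is only continuous and may vanish, so the equation `κ' = w κ` is solved by a scalar
version of Peano's theorem (`exists_hasDerivAt_of_continuous_nonneg`).
-/

/-! ### Scalar autonomous equations with a continuous right-hand side -/

/-- Separation of variables: for a continuous speed `v` bounded away from `0` and `∞`, the inverse
of the travel time `y ↦ ∫ 1 / v` solves `κ' = v κ`. -/
theorem exists_inverse_travelTime {v : ℝ → ℝ} (hv : Continuous v) {ε M : ℝ} (hε : 0 < ε)
    (h1 : ∀ x, ε ≤ v x) (h2 : ∀ x, v x ≤ M) (x₀ : ℝ) :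
    ∃ κ : ℝ → ℝ, κ 0 = x₀ ∧ (∀ t, HasDerivAt κ (v (κ t)) t) ∧
      (∀ t, ∫ y in x₀..κ t, (v y)⁻¹ = t) ∧ StrictMono fun z => ∫ y in x₀..z, (v y)⁻¹ := by
  have hpos : ∀ x, 0 < v x := fun x => hε.trans_le (h1 x)
  have hM : 0 < M := (hpos 0).trans_le (h2 0)
  have hc : Continuous fun y => (v y)⁻¹ := hv.inv₀ fun x => (hpos x).ne'
  set Θ : ℝ → ℝ := fun z => ∫ y in x₀..z, (v y)⁻¹ with hΘ
  have hd : ∀ z, HasDerivAt Θ (v z)⁻¹ z := fun z => hc.integral_hasStrictDerivAt x₀ z |>.hasDerivAt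
  have hΘc : Continuous Θ := continuous_iff_continuousAt.2 fun z => (hd z).continuousAt
  have hmono : StrictMono Θ := strictMono_of_deriv_pos fun z => by
    rw [(hd z).deriv]; exact inv_pos.2 (hpos z)
  have hlin : Monotone fun z => Θ z - M⁻¹ * z := by
    refine monotone_of_deriv_nonneg
      (fun z => ((hd z).fun_sub (hasDerivAt_const_mul M⁻¹)).differentiableAt) fun z => ?_
    rw [((hd z).fun_sub (hasDerivAt_const_mul M⁻¹)).deriv]
    have := inv_anti₀ (hpos z) (h2 z)
    linarith
  have hMi : 0 < M⁻¹ := inv_pos.2 hM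
  have htop : Tendsto Θ atTop atTop := by
    refine tendsto_atTop_mono' atTop (f₁ := fun z => Θ 0 + M⁻¹ * z) ?_
      (tendsto_atTop_add_const_left _ _ (tendsto_id.const_mul_atTop hMi))
    filter_upwards [eventually_ge_atTop 0] with z hz
    have := hlin hz
    simp only at this
    linarith
  have hbot : Tendsto Θ atBot atBot := by
    refine tendsto_atBot_mono' atBot (f₁ := fun z => Θ 0 + M⁻¹ * z) ?_
      (tendsto_atBot_add_const_left _ _ (tendsto_id.const_mul_atBot hMi))
    filter_upwards [eventually_le_atBot 0] with z hz
    have := hlin hz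
    simp only at this
    linarith
  let e : ℝ ≃o ℝ := hmono.orderIsoOfSurjective Θ (hΘc.surjective htop hbot)
  have he : ∀ t, Θ (e.symm t) = t := fun t => e.apply_symm_apply t
  refine ⟨e.symm, ?_, fun t => ?_, he, hmono⟩
  · apply hmono.injective
    rw [he]; simp [hΘ]
  · have := HasDerivAt.of_local_left_inverse (f := Θ) (g := e.symm) (a := t)
      e.symm.continuous.continuousAt (hd (e.symm t)) (inv_ne_zero (hpos _).ne')
      (Eventually.of_forall he)
    simpa using this

/-- Peano's theorem for a nonnegative bounded speed: the solutions for the speeds `w + 1 / (n + 1)`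
are monotone in `n` at every time, and their limit solves the equation. -/
theorem exists_hasDerivAt_of_continuous_nonneg {w : ℝ → ℝ} (hw : Continuous w)
    (h0 : ∀ x, 0 ≤ w x) {W : ℝ} (hW : ∀ x, w x ≤ W) (x₀ : ℝ) :
    ∃ κ : ℝ → ℝ, κ 0 = x₀ ∧ ∀ t, HasDerivAt κ (w (κ t)) t := by
  have hε : ∀ n : ℕ, (0 : ℝ) < 1 / (n + 1) := fun n => Nat.one_div_pos_of_nat
  have hε1 : ∀ n : ℕ, (1 : ℝ) / (n + 1) ≤ 1 := fun n => by
    rw [div_le_one (by positivity)]; linarith [n.cast_nonneg (α := ℝ)]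
  have hvc : ∀ n : ℕ, Continuous fun x => w x + 1 / (n + 1) := fun n => hw.add continuous_const
  choose κ hκ0 hκd hκt hΘm using fun n : ℕ => exists_inverse_travelTime (hvc n) (hε n)
    (fun x => by linarith [h0 x]) (M := W + 1)
    (fun x => add_le_add (hW x) (hε1 n)) x₀
  have hW0 : 0 ≤ W := (h0 0).trans (hW 0)
  have hspeed : ∀ (n : ℕ) x, ‖w x + 1 / ((n : ℝ) + 1)‖ ≤ W + 1 := fun n x => by
    rw [Real.norm_of_nonneg (by linarith [h0 x, hε n])]; linarith [hW x, hε1 n]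
  have hlip : ∀ n s t, |κ n t - κ n s| ≤ (W + 1) * |t - s| := fun n s t =>
    convex_univ.norm_image_sub_le_of_norm_hasDerivWithin_le
      (fun x _ => (hκd n x).hasDerivWithinAt) (fun x _ => hspeed n _) (mem_univ s) (mem_univ t)
  have hinv : ∀ (m n : ℕ), m ≤ n → ∀ y,
      (w y + 1 / ((m : ℝ) + 1))⁻¹ ≤ (w y + 1 / ((n : ℝ) + 1))⁻¹ := by
    intro m n hmn y
    refine inv_anti₀ (by linarith [h0 y, hε n]) ?_
    have : (1 : ℝ) / (n + 1) ≤ 1 / (m + 1) := Nat.one_div_le_one_div hmn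
    linarith
  have hii : ∀ (n : ℕ) (p q : ℝ),
      IntervalIntegrable (fun y => (w y + 1 / ((n : ℝ) + 1))⁻¹) volume p q := fun n p q =>
    ((hvc n).inv₀ fun x => by linarith [h0 x, hε n]).intervalIntegrable p q
  have hm : ∀ n, Monotone (κ n) := fun n => monotone_of_deriv_nonneg
    (fun t => (hκd n t).differentiableAt) fun t => by
      rw [(hκd n t).deriv]; linarith [h0 (κ n t), hε n]
  have hlim : ∀ t, ∃ l, Tendsto (fun n => κ n t) atTop (𝓝 l) := by
    intro t
    have hbd : ∀ n, |κ n t - x₀| ≤ (W + 1) * |t| := fun n => by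
      have := hlip n 0 t
      rwa [hκ0, sub_zero] at this
    rcases le_total 0 t with ht | ht
    · refine ⟨_, tendsto_atTop_ciInf (fun m n hmn => ?_) ⟨x₀ - (W + 1) * |t|, ?_⟩⟩
      · refine (hΘm n).le_iff_le.1 ?_
        simp only [hκt]
        have : x₀ ≤ κ m t := hκ0 m ▸ hm m ht
        conv_lhs => rw [← hκt m t]
        exact intervalIntegral.integral_mono_on this (hii m _ _) (hii n _ _)
          fun y _ => hinv m n hmn y
      · rintro _ ⟨n, rfl⟩
        linarith [(abs_le.1 (hbd n)).1]
    · refine ⟨_, tendsto_atTop_ciSup (fun m n hmn => ?_) ⟨x₀ + (W + 1) * |t|, ?_⟩⟩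
      · refine (hΘm n).le_iff_le.1 ?_
        simp only [hκt]
        have : κ m t ≤ x₀ := hκ0 m ▸ hm m ht
        conv_rhs => rw [← hκt m t]
        rw [intervalIntegral.integral_symm (κ m t), intervalIntegral.integral_symm (κ m t)]
        exact neg_le_neg
          (intervalIntegral.integral_mono_on this (hii m _ _) (hii n _ _) fun y _ => hinv m n hmn y)
      · rintro _ ⟨n, rfl⟩
        linarith [(abs_le.1 (hbd n)).2]
  choose k hk using hlim
  have hklip : ∀ s t, |k t - k s| ≤ (W + 1) * |t - s| := fun s t =>
    le_of_tendsto ((hk t).sub (hk s)).abs (Eventually.of_forall fun n => hlip n s t)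
  have hkc : Continuous k := by
    refine (LipschitzWith.of_dist_le_mul (K := ⟨W + 1, by linarith⟩) fun t s => ?_).continuous
    exact hklip s t
  have hint : ∀ t, k t = x₀ + ∫ s in (0 : ℝ)..t, w (k s) := by
    intro t
    have e : ∀ n, κ n t = x₀ + ∫ s in (0 : ℝ)..t, (w (κ n s) + 1 / ((n : ℝ) + 1)) := by
      intro n
      have hcn : Continuous (κ n) := continuous_iff_continuousAt.2 fun z => (hκd n z).continuousAt
      rw [intervalIntegral.integral_eq_sub_of_hasDerivAt (fun s _ => hκd n s)
        (((hvc n).comp hcn).intervalIntegrable _ _), hκ0]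
      ring
    refine tendsto_nhds_unique (hk t) ?_
    simp_rw [e]
    refine tendsto_const_nhds.add ?_
    refine intervalIntegral.tendsto_integral_filter_of_dominated_convergence (fun _ => W + 1)
      (Eventually.of_forall fun n => ?_) (Eventually.of_forall fun n => ae_of_all _ fun s _ =>
        hspeed n _) intervalIntegrable_const (ae_of_all _ fun s _ => ?_)
    · have hcn : Continuous (κ n) := continuous_iff_continuousAt.2 fun z => (hκd n z).continuousAt
      exact ((hvc n).comp hcn).aestronglyMeasurable
    · simpa using ((hw.tendsto (k s)).comp (hk s)).add tendsto_one_div_add_atTop_nhds_zero_nat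
  refine ⟨k, by simpa using hint 0, fun t => ?_⟩
  have : k = fun t => x₀ + ∫ s in (0 : ℝ)..t, w (k s) := funext hint
  rw [this]
  have := ((hw.comp hkc).integral_hasStrictDerivAt 0 t).hasDerivAt.const_add x₀
  simpa [← hint t] using this

/-! ### Superlinear convex Lagrangians on the line and their critical slopes -/

/-- A Lagrangian `ℓ (x, v)` on the line, with derivative `dℓ` in the velocity: both are continuous,
and `ℓ (x, ·)` is strictly convex and superlinear. -/
structure LineLagrangian (ℓ dℓ : ℝ → ℝ → ℝ) : Prop where
  continuous : Continuous fun q : ℝ × ℝ => ℓ q.1 q.2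
  continuous_deriv : Continuous fun q : ℝ × ℝ => dℓ q.1 q.2
  hasDerivAt : ∀ x v, HasDerivAt (ℓ x) (dℓ x v) v
  strictConvexOn : ∀ x, StrictConvexOn ℝ univ (ℓ x)
  superlinear : ∀ x, Tendsto (fun v => ℓ x v / |v|) (cocompact ℝ) atTop

/-- For every `x`, the interval `[a x, b x]` is the set of slopes `p` with `p v ≤ ℓ (x, v) + c` for
all `v`, that is, the sublevel `{H (x, ·) ≤ c}` of the Hamiltonian; `w x ≥ 0` and `z x ≤ 0` are the
velocities at which equality holds for `p = b x` and for `p = a x`. -/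
structure CriticalSlopes (ℓ : ℝ → ℝ → ℝ) (c : ℝ) (a b w z : ℝ → ℝ) : Prop where
  continuous_a : Continuous a
  continuous_b : Continuous b
  continuous_w : Continuous w
  continuous_z : Continuous z
  w_nonneg : ∀ x, 0 ≤ w x
  z_nonpos : ∀ x, z x ≤ 0
  b_mul_le : ∀ x v, b x * v ≤ ℓ x v + c
  a_mul_le : ∀ x v, a x * v ≤ ℓ x v + c
  b_mul_w : ∀ x, b x * w x = ℓ x (w x) + c
  a_mul_z : ∀ x, a x * z x = ℓ x (z x) + c
  le_b : ∀ x p, (∀ v, p * v ≤ ℓ x v + c) → p ≤ b x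
  a_le : ∀ x p, (∀ v, p * v ≤ ℓ x v + c) → a x ≤ p

namespace LineLagrangian

variable {ℓ dℓ : ℝ → ℝ → ℝ}

theorem continuous_apply (h : LineLagrangian ℓ dℓ) (x : ℝ) : Continuous (ℓ x) :=
  h.continuous.comp (Continuous.prodMk_right x)

theorem continuous_deriv_apply (h : LineLagrangian ℓ dℓ) (x : ℝ) : Continuous (dℓ x) :=
  h.continuous_deriv.comp (Continuous.prodMk_right x)

theorem tangent_lt (h : LineLagrangian ℓ dℓ) (x : ℝ) {u v : ℝ} (huv : u ≠ v) :
    ℓ x u + dℓ x u * (v - u) < ℓ x v := by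
  rcases huv.lt_or_gt with hlt | hlt
  · have := (h.strictConvexOn x).lt_slope_of_hasDerivAt (mem_univ u) (mem_univ v) hlt
      (h.hasDerivAt x u)
    rw [slope_def_field, lt_div_iff₀ (by linarith)] at this
    linarith
  · have := (h.strictConvexOn x).slope_lt_of_hasDerivAt (mem_univ v) (mem_univ u) hlt
      (h.hasDerivAt x u)
    rw [slope_def_field, div_lt_iff₀ (by linarith)] at this
    linarith

theorem tangent_le (h : LineLagrangian ℓ dℓ) (x u v : ℝ) :
    ℓ x u + dℓ x u * (v - u) ≤ ℓ x v := by
  rcases eq_or_ne u v with rfl | huv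
  · simp
  · exact (h.tangent_lt x huv).le

/-- The Lagrangian of the reversed motions. -/
theorem reverse (h : LineLagrangian ℓ dℓ) :
    LineLagrangian (fun x v => ℓ x (-v)) (fun x v => -dℓ x (-v)) where
  continuous := h.continuous.comp (continuous_fst.prodMk continuous_snd.neg)
  continuous_deriv := (h.continuous_deriv.comp (continuous_fst.prodMk continuous_snd.neg)).neg
  hasDerivAt x v := by simpa using! (h.hasDerivAt x (-v)).scomp v (hasDerivAt_neg v)
  strictConvexOn x := by
    refine ⟨convex_univ, fun u _ v _ huv p q hp hq hpq => ?_⟩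
    have := (h.strictConvexOn x).2 (mem_univ (-u)) (mem_univ (-v)) (by simpa using huv) hp hq hpq
    simp only [smul_eq_mul] at this ⊢
    convert this using 2
    ring
  superlinear x := by
    have := (h.superlinear x).comp (Homeomorph.neg ℝ).isClosedEmbedding.tendsto_cocompact
    simpa [Function.comp_def] using this

/-- The energy `v ∂ᵥℓ - ℓ` is strictly increasing in the velocity `v ≥ 0`. -/
theorem energy_strictMonoOn (h : LineLagrangian ℓ dℓ) (x : ℝ) :
    StrictMonoOn (fun v => v * dℓ x v - ℓ x v) (Ici 0) := by
  intro u hu v _ huv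
  have h1 := h.tangent_lt x huv.ne'
  have h2 := h.tangent_lt x huv.ne
  have hd : dℓ x u ≤ dℓ x v := by
    by_contra! hlt
    nlinarith
  have hu' : (0 : ℝ) ≤ u := hu
  simp only
  nlinarith

/-- Superlinearity makes the energy reach every level above that of rest. -/
theorem exists_energy_eq (h : LineLagrangian ℓ dℓ) {c : ℝ} (x : ℝ) (hx : 0 ≤ ℓ x 0 + c) :
    ∃ v, 0 ≤ v ∧ v * dℓ x v - ℓ x v = c := by
  -- The tangent line at `v ≥ 1` lies below `ℓ x 1`, so the energy is large where `dℓ x v` is.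
  obtain ⟨V, hV1, hV⟩ : ∃ V, 1 ≤ V ∧ c ≤ V * dℓ x V - ℓ x V := by
    have hs := (h.superlinear x).mono_left (show atTop ≤ cocompact ℝ from atTop_le_cocompact)
    obtain ⟨V, hV, hV1⟩ := ((hs.eventually_ge_atTop (c + |ℓ x 1| + |ℓ x 0|)).and
      (eventually_ge_atTop 1)).exists
    refine ⟨V, hV1, ?_⟩
    have hV0 : 0 < V := by linarith
    rw [abs_of_pos hV0, le_div_iff₀ hV0] at hV
    have t0 := h.tangent_le x V 0
    have t1 := h.tangent_le x V 1
    have hd : c + ℓ x 1 ≤ dℓ x V := by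
      by_contra! hlt
      have h1 := mul_lt_mul_of_pos_right hlt hV0
      have h2 := mul_le_mul_of_nonneg_right (le_abs_self (ℓ x 1)) hV0.le
      have h3 := le_mul_of_one_le_right (abs_nonneg (ℓ x 0)) hV1
      linarith [le_abs_self (ℓ x 0)]
    linarith
  have hc : ContinuousOn (fun v => v * dℓ x v - ℓ x v) (Icc 0 V) :=
    ((continuous_id.mul (h.continuous_deriv_apply x)).sub (h.continuous_apply x)).continuousOn
  obtain ⟨v, hv, e⟩ := intermediate_value_Icc (by linarith) hc
    (show c ∈ Icc _ _ from ⟨by linarith, hV⟩)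
  exact ⟨v, hv.1, e⟩

/-- The critical slope `b` of the motions with nonnegative velocity. -/
theorem exists_forward_slope (h : LineLagrangian ℓ dℓ) {c : ℝ} (hc : ∀ x, 0 ≤ ℓ x 0 + c) :
    ∃ b w : ℝ → ℝ, Continuous b ∧ Continuous w ∧ (∀ x, 0 ≤ w x) ∧
      (∀ x v, b x * v ≤ ℓ x v + c) ∧ (∀ x, b x * w x = ℓ x (w x) + c) ∧
      ∀ x p, (∀ v, p * v ≤ ℓ x v + c) → p ≤ b x := by
  choose w hw0 hw using fun x => h.exists_energy_eq x (hc x)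
  have hE : ∀ v, Continuous fun x => v * dℓ x v - ℓ x v := fun v =>
    ((h.continuous_deriv.comp (Continuous.prodMk_left v)).const_mul v).sub
      (h.continuous.comp (Continuous.prodMk_left v))
  have hwc : Continuous w := by
    refine continuous_iff_continuousAt.2 fun x => tendsto_order.2 ⟨fun v hv => ?_, fun v hv => ?_⟩
    · rcases lt_or_ge v 0 with hv0 | hv0
      · exact Eventually.of_forall fun y => hv0.trans_le (hw0 y)
      · have hlt := h.energy_strictMonoOn x hv0 (hw0 x) hv
        simp only [hw] at hlt
        filter_upwards [(hE v).continuousAt.eventually_lt_const hlt] with y hy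
        rw [← (h.energy_strictMonoOn y).lt_iff_lt hv0 (hw0 y)]
        simpa only [hw] using hy
    · have hv0 : 0 ≤ v := (hw0 x).trans hv.le
      have hlt := h.energy_strictMonoOn x (hw0 x) hv0 hv
      simp only [hw] at hlt
      filter_upwards [(hE v).continuousAt.eventually_const_lt hlt] with y hy
      rw [← (h.energy_strictMonoOn y).lt_iff_lt (hw0 y) hv0]
      simpa only [hw] using hy
  refine ⟨fun x => dℓ x (w x), w, h.continuous_deriv.comp (continuous_id.prodMk hwc), hwc, hw0,
    fun x v => ?_, fun x => ?_, fun x p hp => ?_⟩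
  · have := h.tangent_le x (w x) v
    have := hw x
    linarith
  · have := hw x
    linarith
  · rcases (hw0 x).eq_or_lt with h0 | hpos
    · -- At velocity zero the slope is a limit of the slopes at small positive velocities.
      have e := hw x
      change p ≤ dℓ x (w x)
      rw [← h0] at e ⊢
      refine ge_of_tendsto ((h.continuous_deriv_apply x).continuousWithinAt (s := Ioi 0)) ?_
      filter_upwards [self_mem_nhdsWithin] with v hv
      have hv' : 0 < v := hv
      have h1 := h.tangent_le x v 0
      have h2 := hp v
      by_contra! hlt
      nlinarith
    · have := hp (w x)
      have := hw x
      by_contra! hlt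
      nlinarith

theorem exists_criticalSlopes (h : LineLagrangian ℓ dℓ) {c : ℝ} (hc : ∀ x, 0 ≤ ℓ x 0 + c) :
    ∃ a b w z : ℝ → ℝ, CriticalSlopes ℓ c a b w z := by
  obtain ⟨b, w, hb, hw, hw0, hle, heq, hmax⟩ := h.exists_forward_slope hc
  obtain ⟨a, z, ha, hz, hz0, hle', heq', hmax'⟩ :=
    h.reverse.exists_forward_slope (c := c) (by simpa using hc)
  refine ⟨fun x => -a x, b, w, fun x => -z x, ha.neg, hb, hw, hz.neg, hw0,
    fun x => by linarith [hz0 x], hle, fun x v => ?_, heq, fun x => ?_, hmax, fun x p hp => ?_⟩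
  · have := hle' x (-v)
    rw [neg_neg] at this
    linarith
  · have := heq' x
    linarith
  · have := hmax' x (-p) fun v => by
      have := hp (-v)
      linarith
    linarith

/-- The supremum of `p v - ℓ (x, v)` over a closed set of velocities is attained. -/
theorem exists_isMaxOn (h : LineLagrangian ℓ dℓ) (x p : ℝ) {S : Set ℝ} (hS : IsClosed S)
    (h0 : S.Nonempty) : ∃ v ∈ S, IsMaxOn (fun v => p * v - ℓ x v) S v := by
  obtain ⟨v₀, hv₀⟩ := h0
  refine ContinuousOn.exists_isMaxOn' ((continuous_const.mul continuous_id).sub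
    (h.continuous_apply x)).continuousOn hS hv₀ (Filter.Eventually.filter_mono inf_le_left ?_)
  have hv1 : ∀ᶠ v in cocompact ℝ, 1 ≤ |v| := by
    have := tendsto_norm_cocompact_atTop (E := ℝ)
    exact this.eventually_ge_atTop 1
  filter_upwards [(h.superlinear x).eventually_ge_atTop (|p| + |p * v₀ - ℓ x v₀|), hv1] with v hv h1
  rw [le_div_iff₀ (by linarith)] at hv
  have h2 : p * v ≤ |p| * |v| := by rw [← abs_mul]; exact le_abs_self _
  have h3 : |p * v₀ - ℓ x v₀| ≤ |p * v₀ - ℓ x v₀| * |v| := le_mul_of_one_le_right (abs_nonneg _) h1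
  have h4 := neg_abs_le (p * v₀ - ℓ x v₀)
  linarith

end LineLagrangian

namespace CriticalSlopes

variable {ℓ dℓ : ℝ → ℝ → ℝ} {c : ℝ} {a b w z : ℝ → ℝ}

theorem rest_nonneg (h : CriticalSlopes ℓ c a b w z) (x : ℝ) : 0 ≤ ℓ x 0 + c := by
  simpa using h.b_mul_le x 0

theorem a_lt_b (h : CriticalSlopes ℓ c a b w z) (hℓ : LineLagrangian ℓ dℓ) {x : ℝ}
    (hx : 0 < ℓ x 0 + c) : a x < b x := by
  by_contra! hba
  have hw : 0 < w x := (h.w_nonneg x).lt_of_ne fun e => by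
    have := h.b_mul_w x
    rw [← e] at this
    linarith
  have hz : z x < 0 := (h.z_nonpos x).lt_of_ne fun e => by
    have := h.a_mul_z x
    rw [e] at this
    linarith
  -- The convex function `ℓ x - a x * ·` would take its minimum `-c` at `z x` and at `w x`.
  have h1 := h.b_mul_w x
  have h2 := h.a_mul_z x
  have t1 := hℓ.tangent_le x 0 (w x)
  have t2 := hℓ.tangent_le x 0 (z x)
  have h3 := h.a_mul_le x (w x)
  have h4 : (dℓ x 0 - a x) * w x < 0 := by nlinarith
  have h5 : (dℓ x 0 - a x) * z x < 0 := by nlinarith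
  nlinarith

theorem mul_lt (h : CriticalSlopes ℓ c a b w z) {x p : ℝ} (hx : 0 < ℓ x 0 + c) (hap : a x < p)
    (hpb : p < b x) (v : ℝ) : p * v < ℓ x v + c := by
  have h1 := h.b_mul_le x v
  have h2 := h.a_mul_le x v
  rcases lt_trichotomy v 0 with hv | rfl | hv
  · nlinarith
  · simpa using hx
  · nlinarith

/-- Only negative velocities attain the critical level for the slope `a`. -/
theorem a_mul_lt (h : CriticalSlopes ℓ c a b w z) (hℓ : LineLagrangian ℓ dℓ) {x v : ℝ}
    (hx : 0 < ℓ x 0 + c) (hv : 0 ≤ v) : a x * v < ℓ x v + c := by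
  have h1 := h.b_mul_le x v
  have h2 := h.a_lt_b hℓ hx
  rcases hv.eq_or_lt with rfl | hv
  · simpa using hx
  · nlinarith

/-- Only positive velocities attain the critical level for the slope `b`. -/
theorem b_mul_lt (h : CriticalSlopes ℓ c a b w z) (hℓ : LineLagrangian ℓ dℓ) {x v : ℝ}
    (hx : 0 < ℓ x 0 + c) (hv : v ≤ 0) : b x * v < ℓ x v + c := by
  have h1 := h.a_mul_le x v
  have h2 := h.a_lt_b hℓ hx
  rcases hv.eq_or_lt with rfl | hv
  · simpa using hx
  · nlinarith

end CriticalSlopes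

/-! ### Viscosity inequalities on a segment -/

/-- A continuous function whose `C¹` upper test functions have nonpositive slopes is
nonincreasing. -/
theorem antitoneOn_of_test {g : ℝ → ℝ} (hg : Continuous g) {p q : ℝ}
    (H : ∀ Φ ψ : ℝ → ℝ, Continuous ψ → (∀ y, HasDerivAt Φ (ψ y) y) → ∀ m ∈ Ioo p q,
      IsLocalMax (fun y => g y - Φ y) m → ψ m ≤ 0) :
    AntitoneOn g (Icc p q) := by
  have key : ∀ x y, p ≤ x → x < y → y < q → g y ≤ g x := by
    intro x y hx hxy hyq
    by_contra! hlt
    -- The exponential is steep enough to the right of `y` to push the maximum inside `(x, q)`.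
    set ε := g y - g x with hε
    have hε0 : 0 < ε := sub_pos.2 hlt
    set k := (|g q - g y| + 1) / (ε * (q - y)) with hk
    have hqy : 0 < q - y := sub_pos.2 hyq
    have hk0 : 0 < k := by positivity
    have hkq : ε * (k * (q - y)) = |g q - g y| + 1 := by
      rw [hk]; field_simp
    set Φ : ℝ → ℝ := fun t => ε * Real.exp (k * (t - y)) with hΦ
    have hd : ∀ t, HasDerivAt Φ (ε * (Real.exp (k * (t - y)) * k)) t := fun t => by
      have h1 : HasDerivAt (fun t => k * (t - y)) k t := by
        simpa using ((hasDerivAt_id t).sub_const y).const_mul k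
      exact h1.exp.const_mul ε
    have hΦc : Continuous Φ := by fun_prop
    obtain ⟨m, hm, hmax⟩ := isCompact_Icc.exists_isMaxOn ⟨y, hxy.le, hyq.le⟩
      ((hg.sub hΦc).continuousOn (s := Icc x q))
    have hΦy : Φ y = ε := by simp [hΦ]
    have hmy : g y - Φ y ≤ g m - Φ m := hmax ⟨hxy.le, hyq.le⟩
    have hmx : x ≠ m := by
      rintro rfl
      have : 0 < Φ x := by positivity
      linarith
    have hmq : m ≠ q := by
      rintro rfl
      have h1 : ε * (k * (m - y) + 1) ≤ Φ m :=
        mul_le_mul_of_nonneg_left (Real.add_one_le_exp _) hε0.le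
      have h2 := le_abs_self (g m - g y)
      nlinarith
    have hm' : m ∈ Ioo x q := ⟨hm.1.lt_of_ne hmx, hm.2.lt_of_ne hmq⟩
    have := H Φ _ (by fun_prop) hd m ⟨hx.trans_lt hm'.1, hm'.2⟩
      (hmax.isLocalMax (Icc_mem_nhds hm'.1 hm'.2))
    have : 0 < ε * (Real.exp (k * (m - y)) * k) := by positivity
    linarith
  intro x hx y hy hxy
  rcases hxy.eq_or_lt with rfl | hxy
  · rfl
  rcases hy.2.lt_or_eq with hyq | rfl
  · exact key x y hx.1 hxy hyq
  · refine le_of_tendsto (hg.continuousWithinAt (s := Iio y) (x := y)) ?_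
    filter_upwards [Ioo_mem_nhdsLT hxy] with t ht using key x t hx.1 ht.1 ht.2

theorem monotoneOn_of_test {g : ℝ → ℝ} (hg : Continuous g) {p q : ℝ}
    (H : ∀ Φ ψ : ℝ → ℝ, Continuous ψ → (∀ y, HasDerivAt Φ (ψ y) y) → ∀ m ∈ Ioo p q,
      IsLocalMax (fun y => g y - Φ y) m → 0 ≤ ψ m) :
    MonotoneOn g (Icc p q) := by
  have := antitoneOn_of_test (g := fun y => g (-y)) (by fun_prop) (p := -q) (q := -p)
    fun Φ ψ hψ hΦ m hm hmax => by
      have := H (fun y => Φ (-y)) (fun y => -ψ (-y)) (by fun_prop)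
        (fun y => by simpa using! (hΦ (-y)).scomp y (hasDerivAt_neg y)) (-m)
        ⟨by linarith [hm.2], by linarith [hm.1]⟩ ?_
      · simpa using this
      · have hc : Tendsto (fun y : ℝ => -y) (𝓝 (-m)) (𝓝 m) := by
          simpa using (continuous_neg (G := ℝ)).tendsto (-m)
        filter_upwards [hc.eventually hmax] with y hy
        simpa using hy
  intro x hx y hy hxy
  simpa using this (a := -y) (b := -x) ⟨by linarith [hy.2], by linarith [hy.1]⟩
    ⟨by linarith [hx.2], by linarith [hx.1]⟩ (by linarith)

/-- Every interval contains a point at which a given continuous function is touched from above by a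
parabola. -/
theorem exists_isLocalMax_sub_C1 {u : ℝ → ℝ} (hu : Continuous u) {p q : ℝ} (hpq : p < q) :
    ∃ Φ ψ : ℝ → ℝ, Continuous ψ ∧ (∀ y, HasDerivAt Φ (ψ y) y) ∧
      ∃ m ∈ Ioo p q, IsLocalMax (fun y => u y - Φ y) m := by
  set x := (p + q) / 2 with hx
  set K := (|u p - u x| + |u q - u x| + 1) / ((q - p) / 2) ^ 2 with hK
  have hKe : K * ((q - p) / 2) ^ 2 = |u p - u x| + |u q - u x| + 1 := by
    have : q - p ≠ 0 := by linarith
    rw [hK]; field_simp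
  have hd : ∀ y, HasDerivAt (fun y => K * (y - x) ^ 2) (K * (2 * (y - x))) y := fun y => by
    simpa using (((hasDerivAt_id y).sub_const x).pow 2).const_mul K
  obtain ⟨m, hm, hmax⟩ := isCompact_Icc.exists_isMaxOn (nonempty_Icc.2 hpq.le)
    ((hu.sub (show Continuous fun y => K * (y - x) ^ 2 by fun_prop)).continuousOn (s := Icc p q))
  have hmx : u x - K * (x - x) ^ 2 ≤ u m - K * (m - x) ^ 2 :=
    hmax (show x ∈ Icc p q from ⟨by linarith, by linarith⟩)
  have hmp : p ≠ m := by
    rintro rfl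
    have e : p - x = -((q - p) / 2) := by rw [hx]; ring
    rw [e, neg_sq, hKe] at hmx
    simp only [sub_self] at hmx
    linarith [le_abs_self (u p - u x), abs_nonneg (u q - u x)]
  have hmq : m ≠ q := by
    rintro rfl
    have e : m - x = (m - p) / 2 := by rw [hx]; ring
    rw [e, hKe] at hmx
    simp only [sub_self] at hmx
    linarith [le_abs_self (u m - u x), abs_nonneg (u p - u x)]
  have hm' : m ∈ Ioo p q := ⟨hm.1.lt_of_ne hmp, hm.2.lt_of_ne hmq⟩
  exact ⟨_, _, by fun_prop, hd, m, hm', hmax.isLocalMax (Icc_mem_nhds hm'.1 hm'.2)⟩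

/-- A solution `u` of `H (x, u') = c` on the segment `[0, s]`, where `[a x, b x]` is the sublevel
`{H (x, ·) ≤ c}`, which is a nontrivial interval wherever `D x ≠ 0`.  The subsolution property is
recorded in integrated form, the supersolution property through test functions. -/
structure SegmentSolution (u a b D : ℝ → ℝ) (s : ℝ) : Prop where
  continuous : Continuous u
  continuous_a : Continuous a
  continuous_b : Continuous b
  continuous_D : Continuous D
  a_lt_b : ∀ x, D x ≠ 0 → a x < b x
  antitoneOn : AntitoneOn (fun y => u y - ∫ t in (0 : ℝ)..y, b t) (Icc 0 s)
  monotoneOn : MonotoneOn (fun y => u y - ∫ t in (0 : ℝ)..y, a t) (Icc 0 s)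
  super : ∀ Φ ψ : ℝ → ℝ, Continuous ψ → (∀ y, HasDerivAt Φ (ψ y) y) → ∀ m ∈ Ioo 0 s,
    IsLocalMin (fun y => u y - Φ y) m → a m < ψ m → b m ≤ ψ m

namespace SegmentSolution

variable {u a b D : ℝ → ℝ} {s : ℝ}

/-- If neither alternative held, a `C¹` function with slopes strictly between `a` and `b` would lie
below `u` at both ends by a larger margin than at `x`, and so would touch it from below inside. -/
theorem sub_eq_or_sub_eq (h : SegmentSolution u a b D s) {p q x : ℝ} (hp : 0 ≤ p) (hq : q ≤ s)
    (hD : ∀ y ∈ Ioo p q, D y ≠ 0) (hx : x ∈ Ioo p q) :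
    u x - u p = (∫ t in p..x, b t) ∨ u q - u x = ∫ t in x..q, a t := by
  have hb := h.continuous_b
  have ha := h.continuous_a
  have hbi : ∀ y z, IntervalIntegrable b volume y z := fun y z => hb.intervalIntegrable y z
  have hai : ∀ y z, IntervalIntegrable a volume y z := fun y z => ha.intervalIntegrable y z
  by_contra! hne
  have h1 : u x - u p < ∫ t in p..x, b t := by
    refine lt_of_le_of_ne ?_ hne.1
    have := h.antitoneOn ⟨hp, by linarith [hx.1, hx.2]⟩
      ⟨by linarith [hx.1], by linarith [hx.2]⟩ hx.1.le
    have e := intervalIntegral.integral_add_adjacent_intervals (hbi 0 p) (hbi p x)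
    simp only at this
    linarith
  have h2 : ∫ t in x..q, a t < u q - u x := by
    refine lt_of_le_of_ne ?_ hne.2.symm
    have := h.monotoneOn ⟨by linarith [hx.1], by linarith [hx.2]⟩
      ⟨by linarith [hx.1, hx.2], hq⟩ hx.2.le
    have e := intervalIntegral.integral_add_adjacent_intervals (hai 0 x) (hai x q)
    simp only at this
    linarith
  -- Slopes strictly between `a` and `b`, close to `b` on the left of `x` and to `a` on the right.
  set θ : ℕ → ℝ → ℝ := fun n y => Real.sigmoid (n * (y - x)) with hθ
  set ψ : ℕ → ℝ → ℝ := fun n y => b y + (a y - b y) * θ n y with hψ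
  have hθc : ∀ n, Continuous (θ n) := fun n => by fun_prop
  have hψc : ∀ n, Continuous (ψ n) := fun n => hb.add ((ha.sub hb).mul (hθc n))
  have hθ0 : ∀ n y, 0 < θ n y := fun n y => Real.sigmoid_pos _
  have hθ1 : ∀ n y, θ n y < 1 := fun n y => Real.sigmoid_lt_one _
  have hbound : ∀ n y, ‖ψ n y‖ ≤ |b y| + |a y - b y| := fun n y => by
    refine (norm_add_le _ _).trans (add_le_add le_rfl ?_)
    rw [norm_mul]
    refine mul_le_of_le_one_right (norm_nonneg _) ?_
    rw [Real.norm_of_nonneg (hθ0 n y).le]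
    exact (hθ1 n y).le
  have hne_ae : ∀ᵐ y : ℝ, y ≠ x := by simp [ae_iff, measure_singleton]
  have lim : ∀ y z (F : ℝ → ℝ), (∀ t ∈ uIoc y z, t ≠ x → Tendsto (fun n => ψ n t) atTop (𝓝 (F t))) →
      Tendsto (fun n => ∫ t in y..z, ψ n t) atTop (𝓝 (∫ t in y..z, F t)) := by
    intro y z F hF
    refine intervalIntegral.tendsto_integral_filter_of_dominated_convergence
      (fun t => |b t| + |a t - b t|) (Eventually.of_forall fun n => (hψc n).aestronglyMeasurable)
      (Eventually.of_forall fun n => ae_of_all _ fun t _ => hbound n t)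
      ((hb.abs.add (ha.sub hb).abs).intervalIntegrable _ _) ?_
    filter_upwards [hne_ae] with t ht htm using hF t htm ht
  have lim1 : Tendsto (fun n => ∫ t in p..x, ψ n t) atTop (𝓝 (∫ t in p..x, b t)) := by
    refine lim p x b fun t ht htx => ?_
    rw [uIoc_of_le hx.1.le] at ht
    have hlt : t - x < 0 := sub_neg.2 (ht.2.lt_of_ne htx)
    have : Tendsto (fun n : ℕ => θ n t) atTop (𝓝 0) := Real.tendsto_sigmoid_atBot.comp
      (tendsto_natCast_atTop_atTop.atTop_mul_const_of_neg hlt)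
    simpa using (this.const_mul (a t - b t)).const_add (b t)
  have lim2 : Tendsto (fun n => ∫ t in x..q, ψ n t) atTop (𝓝 (∫ t in x..q, a t)) := by
    refine lim x q a fun t ht htx => ?_
    rw [uIoc_of_le hx.2.le] at ht
    have hlt : 0 < t - x := sub_pos.2 ht.1
    have : Tendsto (fun n : ℕ => θ n t) atTop (𝓝 1) := Real.tendsto_sigmoid_atTop.comp
      (tendsto_natCast_atTop_atTop.atTop_mul_const hlt)
    simpa using (this.const_mul (a t - b t)).const_add (b t)
  obtain ⟨n, hn1, hn2⟩ := ((lim1.eventually_const_lt h1).and (lim2.eventually_lt_const h2)).exists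
  set Φ : ℝ → ℝ := fun y => ∫ t in x..y, ψ n t with hΦ
  have hΦd : ∀ y, HasDerivAt Φ (ψ n y) y := fun y =>
    ((hψc n).integral_hasStrictDerivAt x y).hasDerivAt
  have hΦc : Continuous Φ := continuous_iff_continuousAt.2 fun y => (hΦd y).continuousAt
  obtain ⟨m, hm, hmin⟩ := isCompact_Icc.exists_isMinOn ⟨x, hx.1.le, hx.2.le⟩
    ((h.continuous.sub hΦc).continuousOn (s := Icc p q))
  have hmx : u m - Φ m ≤ u x - Φ x := hmin ⟨hx.1.le, hx.2.le⟩
  have hΦx : Φ x = 0 := by simp [hΦ]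
  have hmp : p ≠ m := by
    rintro rfl
    have : Φ p = -∫ t in p..x, ψ n t := intervalIntegral.integral_symm _ _
    linarith
  have hmq : m ≠ q := by
    rintro rfl
    linarith
  have hm' : m ∈ Ioo p q := ⟨hm.1.lt_of_ne hmp, hm.2.lt_of_ne hmq⟩
  have hab := h.a_lt_b m (hD m hm')
  have h3 : a m < ψ n m := by
    have := hθ1 n m
    simp only [hψ]
    nlinarith
  have h4 : ψ n m < b m := by
    have := hθ0 n m
    simp only [hψ]
    nlinarith
  exact absurd (h.super Φ (ψ n) (hψc n) hΦd m ⟨by linarith [hm'.1], by linarith [hm'.2]⟩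
    (hmin.isLocalMin (Icc_mem_nhds hm'.1 hm'.2)) h3) (not_le.2 h4)

/-- Between two points the derivative of a solution switches at most once, from `b` to `a`, as long
as `D` does not vanish. -/
theorem exists_switch (h : SegmentSolution u a b D s) {p q : ℝ} (hp : 0 ≤ p) (hpq : p ≤ q)
    (hq : q ≤ s) (hD : ∀ y ∈ Ioo p q, D y ≠ 0) :
    ∃ m ∈ Icc p q, (∀ y ∈ Icc p m, ∀ z ∈ Icc p m, u z - u y = ∫ t in y..z, b t) ∧
      ∀ y ∈ Icc m q, ∀ z ∈ Icc m q, u z - u y = ∫ t in y..z, a t := by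
  have hbi : ∀ y z, IntervalIntegrable b volume y z := fun y z =>
    h.continuous_b.intervalIntegrable y z
  have hai : ∀ y z, IntervalIntegrable a volume y z := fun y z =>
    h.continuous_a.intervalIntegrable y z
  set B : ℝ → ℝ := fun y => u y - ∫ t in (0 : ℝ)..y, b t with hB
  set A : ℝ → ℝ := fun y => u y - ∫ t in (0 : ℝ)..y, a t with hA
  have hBc : Continuous B := h.continuous.sub
    (intervalIntegral.continuous_primitive hbi 0)
  have hAc : Continuous A := h.continuous.sub
    (intervalIntegral.continuous_primitive hai 0)
  have hBe : ∀ y z, u z - u y = (∫ t in y..z, b t) ↔ B z = B y := fun y z => by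
    have e := intervalIntegral.integral_add_adjacent_intervals (hbi 0 y) (hbi y z)
    simp only [hB]
    constructor <;> intro h' <;> linarith
  have hAe : ∀ y z, u z - u y = (∫ t in y..z, a t) ↔ A z = A y := fun y z => by
    have e := intervalIntegral.integral_add_adjacent_intervals (hai 0 y) (hai y z)
    simp only [hA]
    constructor <;> intro h' <;> linarith
  obtain ⟨m, ⟨hm, hmB⟩, hmax⟩ := (isCompact_Icc.inter_right
    (isClosed_singleton.preimage hBc)).exists_isGreatest
    (show (Icc p q ∩ B ⁻¹' {B p}).Nonempty from ⟨p, ⟨le_rfl, hpq⟩, rfl⟩)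
  have hmA : A q = A m := by
    rcases hm.2.eq_or_lt with rfl | hmq
    · rfl
    refine tendsto_nhds_unique (tendsto_const_nhds (x := A q))
      ((hAc.continuousWithinAt (s := Ioi m) (x := m)).congr' ?_)
    filter_upwards [Ioo_mem_nhdsGT hmq] with t ht
    have htI : t ∈ Ioo p q := ⟨hm.1.trans_lt ht.1, ht.2⟩
    rcases h.sub_eq_or_sub_eq hp hq hD htI with h1 | h1
    · exact absurd (hmax ⟨⟨htI.1.le, htI.2.le⟩, (hBe _ _).1 h1⟩) (not_le.2 ht.1)
    · exact ((hAe _ _).1 h1).symm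
  have hBm : ∀ y ∈ Icc p m, B y = B p := fun y hy => by
    have hy0 : y ∈ Icc 0 s := ⟨hp.trans hy.1, (hy.2.trans hm.2).trans hq⟩
    refine le_antisymm (h.antitoneOn ⟨hp, hpq.trans hq⟩ hy0 hy.1) ?_
    have hmB' : B m = B p := hmB
    rw [← hmB']
    exact h.antitoneOn hy0 ⟨hp.trans hm.1, hm.2.trans hq⟩ hy.2
  have hAm : ∀ y ∈ Icc m q, A y = A m := fun y hy => by
    have hy0 : y ∈ Icc 0 s := ⟨(hp.trans hm.1).trans hy.1, hy.2.trans hq⟩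
    refine le_antisymm ?_ (h.monotoneOn ⟨hp.trans hm.1, hm.2.trans hq⟩ hy0 hy.1)
    rw [← hmA]
    exact h.monotoneOn hy0 ⟨hp.trans hpq, hq⟩ hy.2
  exact ⟨m, hm, fun y hy z hz => (hBe y z).2 ((hBm z hz).trans (hBm y hy).symm),
    fun y hy z hz => (hAe y z).2 ((hAm z hz).trans (hAm y hy).symm)⟩

theorem exists_last_zero (hD : Continuous D) {x : ℝ} (hx : 0 ≤ x) :
    ∃ y ∈ Icc 0 x, (y = 0 ∨ D y = 0) ∧ ∀ t ∈ Ioc y x, D t ≠ 0 := by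
  obtain ⟨y, ⟨hy, hy0⟩, hmax⟩ := (isCompact_Icc.inter_right
    ((isClosed_singleton (x := (0 : ℝ))).union
      ((isClosed_singleton (x := (0 : ℝ))).preimage hD))).exists_isGreatest
    (show (Icc 0 x ∩ ({0} ∪ D ⁻¹' {0})).Nonempty from ⟨0, ⟨le_rfl, hx⟩, Or.inl rfl⟩)
  exact ⟨y, hy, hy0, fun t ht h0 =>
    absurd (hmax ⟨⟨hy.1.trans ht.1.le, ht.2⟩, Or.inr h0⟩) (not_le.2 ht.1)⟩

theorem exists_first_zero (hD : Continuous D) {x : ℝ} (hx : x ≤ s) :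
    ∃ y ∈ Icc x s, (y = s ∨ D y = 0) ∧ ∀ t ∈ Ico x y, D t ≠ 0 := by
  obtain ⟨y, ⟨hy, hy0⟩, hmin⟩ := (isCompact_Icc.inter_right ((isClosed_singleton (x := s)).union
    ((isClosed_singleton (x := (0 : ℝ))).preimage hD))).exists_isLeast
    (show (Icc x s ∩ ({s} ∪ D ⁻¹' {0})).Nonempty from ⟨s, ⟨hx, le_rfl⟩, Or.inl rfl⟩)
  exact ⟨y, hy, hy0, fun t ht h0 =>
    absurd (hmin ⟨⟨ht.1, ht.2.le.trans hy.2⟩, Or.inr h0⟩) (not_le.2 ht.2)⟩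

/-- From every point `x` the solution has slope `b` back to an end of the segment or a zero of `D`
on the left, or slope `a` up to such a point on the right. -/
theorem exists_critical_interval (h : SegmentSolution u a b D s) {x : ℝ} (hx : x ∈ Icc 0 s) :
    (∃ y ∈ Icc 0 x, (y = 0 ∨ D y = 0) ∧
      ∀ t ∈ Icc y x, ∀ t' ∈ Icc y x, u t' - u t = ∫ r in t..t', b r) ∨
    ∃ y ∈ Icc x s, (y = s ∨ D y = 0) ∧
      ∀ t ∈ Icc x y, ∀ t' ∈ Icc x y, u t' - u t = ∫ r in t..t', a r := by
  obtain ⟨p, hp, hp0, hpD⟩ := exists_last_zero h.continuous_D hx.1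
  obtain ⟨q, hq, hq0, hqD⟩ := exists_first_zero h.continuous_D hx.2
  obtain ⟨m, hm, hB, hA⟩ := h.exists_switch hp.1 (hp.2.trans hq.1) hq.2 fun y hy =>
    (le_or_gt y x).elim (fun hyx => hpD y ⟨hy.1, hyx⟩) fun hyx => hqD y ⟨hyx.le, hy.2⟩
  rcases le_total x m with hxm | hxm
  · exact Or.inl ⟨p, hp, hp0, fun t ht t' ht' =>
      hB t ⟨ht.1, ht.2.trans hxm⟩ t' ⟨ht'.1, ht'.2.trans hxm⟩⟩
  · exact Or.inr ⟨q, hq, hq0, fun t ht t' ht' =>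
      hA t ⟨hxm.trans ht.1, ht.2⟩ t' ⟨hxm.trans ht'.1, ht'.2⟩⟩

theorem critical_interval_right_end (h : SegmentSolution u a b D s) (hs : 0 ≤ s) :
    (∃ y ∈ Icc 0 s, (y = 0 ∨ D y = 0) ∧
      ∀ t ∈ Icc y s, ∀ t' ∈ Icc y s, u t' - u t = ∫ r in t..t', b r) ∨
    ∃ m ∈ Ico 0 s, ∀ t ∈ Icc m s, ∀ t' ∈ Icc m s, u t' - u t = ∫ r in t..t', a r := by
  obtain ⟨p, hp, hp0, hpD⟩ := exists_last_zero h.continuous_D hs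
  obtain ⟨m, hm, hB, hA⟩ := h.exists_switch hp.1 hp.2 le_rfl fun y hy => hpD y ⟨hy.1, hy.2.le⟩
  rcases hm.2.eq_or_lt with rfl | hms
  · exact Or.inl ⟨p, hp, hp0, hB⟩
  · exact Or.inr ⟨m, ⟨hp.1.trans hm.1, hms⟩, hA⟩

theorem critical_interval_left_end (h : SegmentSolution u a b D s) (hs : 0 ≤ s) :
    (∃ y ∈ Icc 0 s, (y = s ∨ D y = 0) ∧
      ∀ t ∈ Icc 0 y, ∀ t' ∈ Icc 0 y, u t' - u t = ∫ r in t..t', a r) ∨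
    ∃ m ∈ Ioc 0 s, ∀ t ∈ Icc 0 m, ∀ t' ∈ Icc 0 m, u t' - u t = ∫ r in t..t', b r := by
  obtain ⟨q, hq, hq0, hqD⟩ := exists_first_zero h.continuous_D hs
  obtain ⟨m, hm, hB, hA⟩ := h.exists_switch le_rfl hq.1 hq.2 fun y hy => hqD y ⟨hy.1.le, hy.2⟩
  rcases hm.1.eq_or_lt with rfl | hms
  · exact Or.inl ⟨q, hq, hq0, hA⟩
  · exact Or.inr ⟨m, ⟨hms, hm.2.trans hq.2⟩, hB⟩

end SegmentSolution

/-! ### The topology of a metric graph -/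

namespace MetricGraph

variable {V E : Type*} {Γ : MetricGraph V E}

theorem coord_param (j : E) {a : ℝ} (ha : a ∈ Icc 0 (Γ.len j)) : Γ.coord j (Γ.param j a) = a := by
  rcases ha.1.eq_or_lt with rfl | h0
  · rw [param_zero]
    simp [coord, Γ.src_ne_tgt j]
  rcases ha.2.eq_or_lt with rfl | h1
  · rw [param_len]
    simp [coord]
  · simp [param, h0, h1, coord]

theorem param_of_nonpos (j : E) {a : ℝ} (ha : a ≤ 0) : Γ.param j a = .vertex (Γ.src j) := by
  simp [param, ha, ha.not_gt]

theorem param_of_len_le (j : E) {a : ℝ} (ha : Γ.len j ≤ a) : Γ.param j a = .vertex (Γ.tgt j) := by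
  have := (Γ.len_pos j).trans_le ha
  simp [param, ha.not_gt, this.not_ge]

theorem param_of_mem_Ioo (j : E) {a : ℝ} (ha : a ∈ Ioo 0 (Γ.len j)) :
    Γ.param j a = .interior j ⟨a, ha⟩ :=
  param_interior Γ j ⟨a, ha⟩

theorem param_eq_vertex {j : E} {a : ℝ} (ha : a ∈ Icc 0 (Γ.len j)) {e : V}
    (h : Γ.param j a = .vertex e) : (a = 0 ∧ Γ.src j = e) ∨ (a = Γ.len j ∧ Γ.tgt j = e) := by
  rcases ha.1.eq_or_lt with rfl | h0
  · rw [param_zero] at h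
    exact Or.inl ⟨rfl, by simpa using h⟩
  rcases ha.2.eq_or_lt with rfl | h1
  · rw [param_len] at h
    exact Or.inr ⟨rfl, by simpa using h⟩
  · rw [param_of_mem_Ioo j ⟨h0, h1⟩] at h
    simp at h

theorem param_eq_param {i j : E} {a b : ℝ} (ha : a ∈ Icc 0 (Γ.len i)) (hb : b ∈ Ioo 0 (Γ.len j))
    (h : Γ.param i a = Γ.param j b) : i = j ∧ a = b := by
  rw [param_of_mem_Ioo j hb] at h
  rcases ha.1.eq_or_lt with rfl | h0
  · rw [param_zero] at h
    simp at h
  rcases ha.2.eq_or_lt with rfl | h1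
  · rw [param_len] at h
    simp at h
  · rw [param_of_mem_Ioo i ⟨h0, h1⟩] at h
    injection h with h1 h2
    subst h1
    exact ⟨rfl, congrArg Subtype.val (eq_of_heq h2)⟩

theorem param_clamp (j : E) (a : ℝ) :
    Γ.param j (projIcc 0 (Γ.len j) (Γ.len_pos j).le a) = Γ.param j a := by
  rcases le_or_gt a 0 with h0 | h0
  · rw [projIcc_of_le_left _ h0, param_zero, param_of_nonpos j h0]
  rcases le_or_gt (Γ.len j) a with h1 | h1
  · rw [projIcc_of_right_le _ h1, param_len, param_of_len_le j h1]
  · rw [projIcc_of_mem _ ⟨h0.le, h1.le⟩]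

theorem dist_le_of_chain {x y : Γ.Point} {l : ℝ} (h : Γ.Chain x y l) : dist x y ≤ l :=
  csInf_le (pathDist_bddBelow x y) h

theorem lipschitzWith_param (j : E) : LipschitzWith 1 (Γ.param j) := by
  have h : LipschitzWith 1 fun x : Icc 0 (Γ.len j) => Γ.param j x :=
    LipschitzWith.of_dist_le_mul fun x y => by
      simpa [Subtype.dist_eq, Real.dist_eq] using dist_le_of_chain (Chain.segment j x.2 y.2)
  have := h.comp (LipschitzWith.projIcc (Γ.len_pos j).le)
  rw [mul_one] at this
  convert this using 1
  exact funext fun a => (param_clamp j a).symm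

/-- A function is Lipschitz for the path distance if it is so along every edge. -/
theorem lipschitzWith_of_edges {F : Γ.Point → ℝ} {K : NNReal}
    (h : ∀ j, ∀ a ∈ Icc 0 (Γ.len j), ∀ b ∈ Icc 0 (Γ.len j),
      |F (Γ.param j a) - F (Γ.param j b)| ≤ K * |a - b|) : LipschitzWith K F := by
  have hc : ∀ {x y : Γ.Point} {l : ℝ}, Γ.Chain x y l → |F x - F y| ≤ K * l := by
    intro x y l hl
    induction hl with
    | refl => simp
    | cons j a b ha hb y l _ ih =>
      have := abs_sub_le (F (Γ.param j a)) (F (Γ.param j b)) (F y)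
      have := h j a ha b hb
      linarith
  refine LipschitzWith.of_dist_le_mul fun x y => ?_
  refine le_of_forall_pos_le_add fun ε hε => ?_
  obtain ⟨l, hl, hlt⟩ := Real.lt_sInf_add_pos (exists_chain x y)
    (show 0 < ε / (K + 1) by positivity)
  have h1 : dist (F x) (F y) ≤ K * l := hc hl
  have h2 : l < dist x y + ε / (K + 1) := hlt
  have h3 : (K : ℝ) * l ≤ K * (dist x y + ε / (K + 1)) := mul_le_mul_of_nonneg_left h2.le K.2
  have h4 : (K : ℝ) * (ε / (K + 1)) ≤ ε := by
    rw [mul_div_assoc', div_le_iff₀ (by positivity)]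
    nlinarith [K.2]
  linarith

/-- The function with values `G` at the vertices which is affine on every edge. -/
noncomputable def interpolate (Γ : MetricGraph V E) (G : V → ℝ) : Γ.Point → ℝ
  | .vertex v => G v
  | .interior i x => G (Γ.src i) + x / Γ.len i * (G (Γ.tgt i) - G (Γ.src i))

theorem interpolate_param (G : V → ℝ) (i : E) {a : ℝ} (ha : a ∈ Icc 0 (Γ.len i)) :
    Γ.interpolate G (Γ.param i a) = G (Γ.src i) + a / Γ.len i * (G (Γ.tgt i) - G (Γ.src i)) := by
  rcases ha.1.eq_or_lt with rfl | h0
  · rw [param_zero]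
    simp [interpolate]
  rcases ha.2.eq_or_lt with rfl | h1
  · rw [param_len, div_self (Γ.len_pos i).ne']
    simp [interpolate]
  · rw [param_of_mem_Ioo i ⟨h0, h1⟩]
    rfl

theorem exists_lipschitzWith_interpolate [Finite E] (G : V → ℝ) :
    ∃ K, LipschitzWith K (Γ.interpolate G) := by
  obtain ⟨K, hK⟩ := (finite_range fun i : E => ‖(G (Γ.tgt i) - G (Γ.src i)) / Γ.len i‖₊).bddAbove
  refine ⟨K, lipschitzWith_of_edges fun j a ha b hb => ?_⟩
  have hKj : ‖(G (Γ.tgt j) - G (Γ.src j)) / Γ.len j‖ ≤ K := hK ⟨j, rfl⟩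
  rw [interpolate_param G j ha, interpolate_param G j hb]
  have e : G (Γ.src j) + a / Γ.len j * (G (Γ.tgt j) - G (Γ.src j)) -
      (G (Γ.src j) + b / Γ.len j * (G (Γ.tgt j) - G (Γ.src j))) =
      (G (Γ.tgt j) - G (Γ.src j)) / Γ.len j * (a - b) := by ring
  rw [e, abs_mul]
  exact mul_le_mul_of_nonneg_right hKj (abs_nonneg _)

/-- The coordinate along an edge extends to a Lipschitz function on the graph. -/
theorem exists_lipschitz_coord [Finite E] (j : E) : ∃ (K : NNReal) (F : Γ.Point → ℝ),
    LipschitzWith K F ∧ ∀ a ∈ Icc 0 (Γ.len j), F (Γ.param j a) = a := by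
  classical
  set G : V → ℝ := fun v => if v = Γ.tgt j then Γ.len j else 0 with hG
  obtain ⟨K, hK⟩ := exists_lipschitzWith_interpolate (Γ := Γ) G
  refine ⟨K, _, hK, fun a ha => ?_⟩
  have := (Γ.len_pos j).ne'
  rw [interpolate_param G j ha]
  simp [hG, Γ.src_ne_tgt j, this]

theorem isOpen_edge (j : E) : IsOpen (Γ.param j '' Ioo 0 (Γ.len j)) := by
  classical
  -- The distance to the ends of the edge, extended by `0`, is a Lipschitz function.
  let T : Γ.Point → ℝ := fun p => match p with
    | .vertex _ => 0
    | .interior i x => if i = j then min (x : ℝ) (Γ.len i - x) else 0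
  have hTj : ∀ a ∈ Icc 0 (Γ.len j), T (Γ.param j a) = min a (Γ.len j - a) := fun a ha => by
    rcases ha.1.eq_or_lt with rfl | h0
    · rw [param_zero]
      simp [T, (Γ.len_pos j).le]
    rcases ha.2.eq_or_lt with rfl | h1
    · rw [param_len]
      simp [T, (Γ.len_pos j).le]
    · rw [param_of_mem_Ioo j ⟨h0, h1⟩]
      simp [T]
  have hTi : ∀ i ≠ j, ∀ a ∈ Icc 0 (Γ.len i), T (Γ.param i a) = 0 := fun i hi a ha => by
    rcases ha.1.eq_or_lt with rfl | h0
    · rw [param_zero]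
    rcases ha.2.eq_or_lt with rfl | h1
    · rw [param_len]
    · rw [param_of_mem_Ioo i ⟨h0, h1⟩]
      simp [T, hi]
  have hT : LipschitzWith 1 T := lipschitzWith_of_edges fun i a ha b hb => by
    rcases eq_or_ne i j with rfl | hi
    · rw [hTj a ha, hTj b hb]
      refine (abs_min_sub_min_le_max _ _ _ _).trans (max_le (by simp) ?_)
      rw [sub_sub_sub_cancel_left, abs_sub_comm]
      simp
    · rw [hTi i hi a ha, hTi i hi b hb]
      simp
  convert isOpen_Ioi.preimage hT.continuous (t := Ioi (0 : ℝ)) using 1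
  ext p
  constructor
  · rintro ⟨a, ha, rfl⟩
    rw [mem_preimage, hTj a ⟨ha.1.le, ha.2.le⟩]
    exact lt_min ha.1 (sub_pos.2 ha.2)
  · intro hp
    cases p with
    | vertex v => exact absurd (show (0 : ℝ) < 0 from hp) (lt_irrefl _)
    | interior i x =>
      by_cases hi : i = j
      · subst hi
        exact ⟨x, x.2, param_interior Γ i x⟩
      · simp [T, hi] at hp

/-- The parametrization of the interior of an edge is open. -/
theorem eventually_mem_edge [Finite E] {j : E} {x : ℝ} (hx : x ∈ Ioo 0 (Γ.len j)) {S : Set ℝ}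
    (hS : S ∈ 𝓝 x) : ∀ᶠ p in 𝓝 (Γ.param j x), ∃ y ∈ S ∩ Ioo 0 (Γ.len j), p = Γ.param j y := by
  obtain ⟨K, F, hF, hFa⟩ := exists_lipschitz_coord (Γ := Γ) j
  have hc : Tendsto F (𝓝 (Γ.param j x)) (𝓝 x) := by
    have := hF.continuous.tendsto (Γ.param j x)
    rwa [hFa x ⟨hx.1.le, hx.2.le⟩] at this
  filter_upwards [(isOpen_edge j).mem_nhds ⟨x, hx, rfl⟩, hc hS] with p hp hpS
  obtain ⟨y, hy, rfl⟩ := hp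
  rw [mem_preimage, hFa y ⟨hy.1.le, hy.2.le⟩] at hpS
  exact ⟨y, ⟨hpS, hy⟩, rfl⟩

end MetricGraph

/-! ### Lipschitz curves and their actions -/

namespace GraphLagrangian

open MetricGraph

variable {V E : Type*} {Γ : MetricGraph V E} (L : GraphLagrangian Γ)

/-- The Lagrangian of the edge `j`, extended to all of `ℝ` by its values at the ends. -/
noncomputable def edge (j : E) (x v : ℝ) : ℝ :=
  L.toFun j (projIcc 0 (Γ.len j) (Γ.len_pos j).le x) v

theorem edge_of_mem {j : E} {x : ℝ} (hx : x ∈ Icc 0 (Γ.len j)) (v : ℝ) :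
    L.edge j x v = L.toFun j x v := by
  rw [edge, projIcc_of_mem _ hx]

theorem lineLagrangian_edge (j : E) :
    LineLagrangian (L.edge j) (fun x v => deriv (L.edge j x) v) := by
  have hl := Γ.len_pos j
  set D : Set (ℝ × ℝ) := Icc 0 (Γ.len j) ×ˢ univ with hD
  have hU : UniqueDiffOn ℝ D := (uniqueDiffOn_Icc hl).prod uniqueDiffOn_univ
  have hp : Continuous fun q : ℝ × ℝ => ((projIcc 0 (Γ.len j) hl.le q.1 : ℝ), q.2) :=
    (continuous_subtype_val.comp (continuous_projIcc.comp continuous_fst)).prodMk continuous_snd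
  have hpD : ∀ q : ℝ × ℝ, ((projIcc 0 (Γ.len j) hl.le q.1 : ℝ), q.2) ∈ D := fun q =>
    ⟨Subtype.coe_prop _, mem_univ _⟩
  have hd : ∀ x v, HasDerivAt (L.edge j x)
      (fderivWithin ℝ (fun q : ℝ × ℝ => L.toFun j q.1 q.2) D
        ((projIcc 0 (Γ.len j) hl.le x : ℝ), v) (0, 1)) v := by
    intro x v
    have h1 := ((L.contDiffOn j).differentiableOn (by norm_num) _ (hpD (x, v))).hasFDerivWithinAt
    have h2 : HasDerivWithinAt (fun v : ℝ => ((projIcc 0 (Γ.len j) hl.le x : ℝ), v))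
        (0, 1) univ v :=
      ((hasDerivAt_const v _).prodMk (hasDerivAt_id v)).hasDerivWithinAt
    have := h1.comp_hasDerivWithinAt v h2 fun v _ => hpD (x, v)
    simpa using! this
  refine ⟨?_, ?_, fun x v => ?_, fun x => ?_, fun x => ?_⟩
  · exact (L.contDiffOn j).continuousOn.comp_continuous hp hpD
  · simp_rw [fun x v => (hd x v).deriv]
    have h1 := (L.contDiffOn j).continuousOn_fderivWithin hU (by norm_num)
    exact (h1.comp_continuous hp hpD).clm_apply continuous_const
  · rw [(hd x v).deriv]
    exact hd x v
  · exact L.strictConvexOn j _ (Subtype.coe_prop _)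
  · exact L.superlinear j _ (Subtype.coe_prop _)

variable {L}

theorem along_congr {γ γ' : ℝ → Γ.Point} {t : ℝ} (h : γ =ᶠ[𝓝 t] γ') :
    L.along γ t = L.along γ' t := by
  have hv : velocity γ t = velocity γ' t := by
    rw [velocity, velocity, h.eq_of_nhds]
    cases γ' t with
    | vertex v => rfl
    | interior j x => exact (h.fun_comp (Γ.coord j)).deriv_eq
  rw [along, along, h.eq_of_nhds, hv]

theorem along_comp_add (γ : ℝ → Γ.Point) (d t : ℝ) :
    L.along (fun s => γ (s + d)) t = L.along γ (t + d) := by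
  have hv : velocity (fun s => γ (s + d)) t = velocity γ (t + d) := by
    rw [velocity, velocity]
    cases γ (t + d) with
    | vertex v => rfl
    | interior j x => exact deriv_comp_add_const (fun s => Γ.coord j (γ s)) d t
  rw [along, along, hv]

theorem along_interior {γ : ℝ → Γ.Point} {κ : ℝ → ℝ} {j : E} {t v : ℝ}
    (hκ : κ t ∈ Ioo 0 (Γ.len j))
    (hγ : ∀ᶠ s in 𝓝 t, κ s ∈ Ioo 0 (Γ.len j) ∧ γ s = Γ.param j (κ s)) (hd : HasDerivAt κ v t) :
    L.along γ t = L.toFun j (κ t) v := by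
  have h1 : γ t = .interior j ⟨κ t, hκ⟩ := hγ.self_of_nhds.2.trans (param_of_mem_Ioo j hκ)
  have h2 : (fun s => Γ.coord j (γ s)) =ᶠ[𝓝 t] κ := by
    filter_upwards [hγ] with s hs
    rw [hs.2, coord_param j ⟨hs.1.1.le, hs.1.2.le⟩]
  rw [along, velocity, h1]
  simp only [eval]
  rw [h2.deriv_eq, hd.deriv]

/-- Along a differentiable curve in an edge the integrand of the action is the Lagrangian of the
edge; at an end of the edge the derivative vanishes, the end being an extremum. -/
theorem along_param {κ : ℝ → ℝ} {j : E} {t v : ℝ} (hκ : ∀ᶠ s in 𝓝 t, κ s ∈ Icc 0 (Γ.len j))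
    (hd : HasDerivAt κ v t) : L.along (fun s => Γ.param j (κ s)) t = L.toFun j (κ t) v := by
  have ht := hκ.self_of_nhds
  have hrest : ∀ e, Γ.param j (κ t) = .vertex e → IsLocalExtr κ t →
      L.along (fun s => Γ.param j (κ s)) t = L.toFun j (κ t) v := fun e he hext => by
    rw [along, he, hext.hasDerivAt_eq_zero hd, L.atRest_eq j _ ht e he]
    rfl
  rcases ht.1.eq_or_lt with h0 | h0
  · refine hrest (Γ.src j) (by rw [← h0, param_zero]) (Or.inl ?_)
    filter_upwards [hκ] with s hs
    rw [← h0]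
    exact hs.1
  rcases ht.2.eq_or_lt with h1 | h1
  · refine hrest (Γ.tgt j) (by rw [h1, param_len]) (Or.inr ?_)
    filter_upwards [hκ] with s hs
    rw [h1]
    exact hs.2
  · exact along_interior ⟨h0, h1⟩
      ((hd.continuousAt.eventually (Ioo_mem_nhds h0 h1)).mono fun s hs => ⟨hs, rfl⟩) hd

/-- The curve `γ` is Lipschitz on `[s, t]`, with action `A` there. -/
def HasAction (L : GraphLagrangian Γ) (γ : ℝ → Γ.Point) (s t A : ℝ) : Prop :=
  (∃ K, LipschitzOnWith K γ (Icc s t)) ∧ IntervalIntegrable (L.along γ) volume s t ∧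
    L.action γ s t = A

namespace HasAction

variable {γ γ' : ℝ → Γ.Point} {s t r A B : ℝ}

theorem finiteAction (h : L.HasAction γ s t A) (hst : s ≤ t) : L.FiniteAction γ s t := by
  obtain ⟨K, hK⟩ := h.1
  rw [← uIcc_of_le hst] at hK
  exact ⟨hK.absolutelyContinuousOnInterval, h.2.1⟩

theorem congr (h : L.HasAction γ s t A) (hst : s ≤ t) (he : EqOn γ γ' (Icc s t)) :
    L.HasAction γ' s t A := by
  have ha : EqOn (L.along γ) (L.along γ') (Ioo s t) := fun τ hτ =>
    along_congr (he.eventuallyEq_of_mem (Icc_mem_nhds hτ.1 hτ.2))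
  refine ⟨h.1.imp fun K hK => ?_, h.2.1.congr_uIoo (by rwa [uIoo_of_le hst]), ?_⟩
  · intro x hx y hy
    rw [← he hx, ← he hy]
    exact hK hx hy
  · rw [← h.2.2]
    exact (intervalIntegral.integral_congr_Ioo_of_le hst ha).symm

theorem comp_add (d : ℝ) (h : L.HasAction γ (s + d) (t + d) A) :
    L.HasAction (fun τ => γ (τ + d)) s t A := by
  have e : L.along (fun τ => γ (τ + d)) = fun τ => L.along γ (τ + d) :=
    funext fun τ => along_comp_add γ d τ
  refine ⟨h.1.imp fun K hK => ?_, ?_, ?_⟩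
  · intro x hx y hy
    have := hK (x := x + d) (y := y + d) ⟨by linarith [hx.1], by linarith [hx.2]⟩
      ⟨by linarith [hy.1], by linarith [hy.2]⟩
    simpa using this
  · rw [e]
    exact (IntervalIntegrable.comp_add_right_iff (by finiteness)).2 h.2.1
  · rw [← h.2.2, action, e]
    exact intervalIntegral.integral_comp_add_right (L.along γ) d

theorem trans (h : L.HasAction γ s t A) (h' : L.HasAction γ t r B) (hst : s ≤ t) (htr : t ≤ r) :
    L.HasAction γ s r (A + B) := by
  obtain ⟨K, hK⟩ := h.1
  obtain ⟨M, hM⟩ := h'.1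
  have hK1 := hK.weaken (le_max_left K M)
  have hM1 := hM.weaken (le_max_right K M)
  refine ⟨⟨max K M, LipschitzOnWith.of_dist_le_mul ?_⟩, h.2.1.trans h'.2.1, ?_⟩
  · have hlt : ∀ x ∈ Icc s r, ∀ y ∈ Icc s r, x ≤ y →
        dist (γ x) (γ y) ≤ (max K M : NNReal) * dist x y := by
      intro x hx y hy hxy
      rcases le_total y t with hyt | hyt
      · exact hK1.dist_le_mul x ⟨hx.1, hxy.trans hyt⟩ y ⟨hy.1, hyt⟩
      rcases le_total t x with hxt | hxt
      · exact hM1.dist_le_mul x ⟨hxt, hx.2⟩ y ⟨hyt, hy.2⟩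
      have h1 := hK1.dist_le_mul x ⟨hx.1, hxt⟩ t ⟨hst, le_rfl⟩
      have h2 := hM1.dist_le_mul t ⟨le_rfl, htr⟩ y ⟨hyt, hy.2⟩
      have h3 := dist_triangle (γ x) (γ t) (γ y)
      rw [Real.dist_eq, abs_of_nonpos (by linarith)] at h1 h2 ⊢
      linarith
    intro x hx y hy
    rcases le_total x y with hxy | hxy
    · exact hlt x hx y hy hxy
    · rw [dist_comm, dist_comm x]
      exact hlt y hy x hx hxy
  · rw [← h.2.2, ← h'.2.2]
    exact (intervalIntegral.integral_add_adjacent_intervals h.2.1 h'.2.1).symm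

end HasAction

theorem hasAction_param {κ κ' g : ℝ → ℝ} {j : E} {s t : ℝ} {K : NNReal} (hst : s ≤ t)
    (hK : LipschitzOnWith K κ (Icc s t)) (hκ : ∀ τ ∈ Icc s t, κ τ ∈ Icc 0 (Γ.len j))
    (hd : ∀ τ ∈ Ioo s t, HasDerivAt κ (κ' τ) τ) (hg : Continuous g)
    (hgκ : ∀ τ ∈ Ioo s t, L.toFun j (κ τ) (κ' τ) = g τ) :
    L.HasAction (fun τ => Γ.param j (κ τ)) s t (∫ τ in s..t, g τ) := by
  have ha : EqOn g (L.along fun τ => Γ.param j (κ τ)) (Ioo s t) := fun τ hτ => by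
    rw [← hgκ τ hτ]
    exact (along_param (mem_of_superset (Icc_mem_nhds hτ.1 hτ.2) hκ) (hd τ hτ)).symm
  exact ⟨⟨_, (lipschitzWith_param j).comp_lipschitzOnWith hK⟩,
    (hg.intervalIntegrable s t).congr_uIoo (by rwa [uIoo_of_le hst]),
    (intervalIntegral.integral_congr_Ioo_of_le hst ha).symm⟩

/-- The point `x` is joined to `y` by a Lipschitz curve of duration `T` and action `A`. -/
def Joins (L : GraphLagrangian Γ) (T A : ℝ) (x y : Γ.Point) : Prop :=
  ∃ γ : ℝ → Γ.Point, L.HasAction γ 0 T A ∧ γ 0 = x ∧ γ T = y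

theorem Joins.trans {T S A B : ℝ} {x y z : Γ.Point} (h : L.Joins T A x y) (h' : L.Joins S B y z)
    (hT : 0 ≤ T) (hS : 0 ≤ S) : L.Joins (T + S) (A + B) x z := by
  obtain ⟨γ, hγ, rfl, rfl⟩ := h
  obtain ⟨δ, hδ, hδ0, rfl⟩ := h'
  have h2 : L.HasAction (fun τ => δ (τ + -T)) T (T + S) B :=
    HasAction.comp_add (-T) (by simpa using hδ)
  refine ⟨fun τ => if τ ≤ T then γ τ else δ (τ + -T), ?_, by simp [hT], ?_⟩
  · refine (hγ.congr hT fun τ hτ => ?_).trans (h2.congr (by linarith) fun τ hτ => ?_) hT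
      (by linarith)
    · simp [hτ.2]
    · rcases hτ.1.eq_or_lt with rfl | hlt
      · simp [hδ0]
      · simp [hlt.not_ge]
  · rcases hS.eq_or_lt with rfl | hlt
    · simp [hδ0]
    · simp [hlt]

theorem joins_param (j : E) {a b : ℝ} (ha : a ∈ Icc 0 (Γ.len j)) (hb : b ∈ Icc 0 (Γ.len j))
    {T : ℝ} (hT : 0 < T) : ∃ A, L.Joins T A (Γ.param j a) (Γ.param j b) := by
  set v := (b - a) / T with hv
  have hvT : v * T = b - a := div_mul_cancel₀ _ hT.ne'
  have hd : ∀ τ, HasDerivAt (fun τ => a + v * τ) v τ := fun τ =>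
    (hasDerivAt_const_mul v).const_add a
  have hmem : ∀ τ ∈ Icc 0 T, a + v * τ ∈ Icc 0 (Γ.len j) := fun τ hτ => by
    have e : a + v * τ = (1 - τ / T) • a + (τ / T) • b := by
      simp only [smul_eq_mul, hv]; field_simp; ring
    rw [e]
    exact (convex_Icc 0 (Γ.len j)) ha hb (sub_nonneg.2 ((div_le_one hT).2 hτ.2))
      (div_nonneg hτ.1 hT.le) (by ring)
  have hlip : LipschitzWith ‖v‖₊ fun τ => a + v * τ := LipschitzWith.of_dist_le_mul fun x y => by
    simp [Real.dist_eq, ← mul_sub, abs_mul]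
  have := hasAction_param (L := L) (κ' := fun _ => v) (g := fun τ => L.edge j (a + v * τ) v) hT.le
    hlip.lipschitzOnWith hmem (fun τ _ => hd τ)
    ((L.lineLagrangian_edge j).continuous.comp
      (show Continuous fun τ => (a + v * τ, v) by fun_prop))
    (fun τ hτ => (L.edge_of_mem (hmem τ ⟨hτ.1.le, hτ.2.le⟩) v).symm)
  exact ⟨_, _, this, by simp, by simp [hvT]⟩

theorem joins_refl (L : GraphLagrangian Γ) (x : Γ.Point) (T : ℝ) :
    L.Joins T (T * L.eval x 0) x x := by
  have ha : L.along (fun _ => x) = fun _ => L.eval x 0 := funext fun t => by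
    cases x <;> simp [along, velocity]
  refine ⟨fun _ => x, ⟨⟨0, (LipschitzWith.const x).lipschitzOnWith⟩, ?_, ?_⟩, rfl, rfl⟩
  · rw [ha]
    exact intervalIntegrable_const
  · simp [action, ha]

/-- Action minimisation is never over an empty set of curves. -/
theorem exists_joins (L : GraphLagrangian Γ) (x y : Γ.Point) {T : ℝ} (hT : 0 < T) :
    ∃ A, L.Joins T A x y := by
  obtain ⟨l, hl⟩ := exists_chain x y
  induction hl generalizing T with
  | refl x => exact ⟨_, L.joins_refl x T⟩
  | cons j a b ha hb y l _ ih =>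
    obtain ⟨A, hA⟩ := joins_param (L := L) j ha hb (half_pos hT)
    obtain ⟨B, hB⟩ := ih (half_pos hT)
    have := hA.trans hB (half_pos hT).le (half_pos hT).le
    rw [add_halves] at this
    exact ⟨_, this⟩

end GraphLagrangian

/-! ### Domination -/

theorem LipschitzWith.comp_absolutelyContinuousOnInterval {X : Type*} [PseudoMetricSpace X]
    {M : NNReal} {F : X → ℝ} (hF : LipschitzWith M F) {γ : ℝ → X} {s t : ℝ}
    (hγ : AbsolutelyContinuousOnInterval γ s t) :
    AbsolutelyContinuousOnInterval (fun τ => F (γ τ)) s t := by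
  refine squeeze_zero (fun _ => Finset.sum_nonneg fun _ _ => dist_nonneg) (fun I => ?_)
    (by simpa using Tendsto.const_mul (M : ℝ) hγ)
  rw [Finset.mul_sum]
  exact Finset.sum_le_sum fun i _ => hF.dist_le_mul _ _

namespace GraphLagrangian

open MetricGraph

variable {V E : Type*} {Γ : MetricGraph V E} {L : GraphLagrangian Γ}

/-- What the viscosity inequalities say about `f`: on each edge it is a solution in the sense of
`SegmentSolution`, and at each vertex `e` either resting costs nothing, or some edge with an end at
`e` carries, next to that end, the critical slope of the motions that arrive at `e`. -/
structure CriticalSolution (L : GraphLagrangian Γ) (c : ℝ) (f : Γ.Point → ℝ)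
    (a b w z : E → ℝ → ℝ) : Prop where
  slopes : ∀ j, CriticalSlopes (L.edge j) c (a j) (b j) (w j) (z j)
  segment : ∀ j, SegmentSolution (fun x => f (Γ.param j x)) (a j) (b j)
    (fun x => L.edge j x 0 + c) (Γ.len j)
  rest_nonneg : ∀ e, 0 ≤ L.atRest e + c
  arrival : ∀ e, L.atRest e + c = 0 ∨ ∃ j,
    (Γ.tgt j = e ∧ ∃ y ∈ Icc 0 (Γ.len j), (y = 0 ∨ L.edge j y 0 + c = 0) ∧
      ∀ t ∈ Icc y (Γ.len j), ∀ t' ∈ Icc y (Γ.len j),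
        f (Γ.param j t') - f (Γ.param j t) = ∫ r in t..t', b j r) ∨
    (Γ.src j = e ∧ ∃ y ∈ Icc 0 (Γ.len j), (y = Γ.len j ∨ L.edge j y 0 + c = 0) ∧
      ∀ t ∈ Icc 0 y, ∀ t' ∈ Icc 0 y,
        f (Γ.param j t') - f (Γ.param j t) = ∫ r in t..t', a j r)

namespace CriticalSolution

variable {c : ℝ} {f : Γ.Point → ℝ} {a b w z : E → ℝ → ℝ}

theorem sub_le_integral_b (h : L.CriticalSolution c f a b w z) {j : E} {x y : ℝ}
    (hx : x ∈ Icc 0 (Γ.len j)) (hy : y ∈ Icc 0 (Γ.len j)) (hxy : x ≤ y) :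
    f (Γ.param j y) - f (Γ.param j x) ≤ ∫ r in x..y, b j r := by
  have hi : ∀ p q, IntervalIntegrable (b j) volume p q := fun p q =>
    (h.segment j).continuous_b.intervalIntegrable p q
  have h1 := (h.segment j).antitoneOn hx hy hxy
  have h2 := intervalIntegral.integral_add_adjacent_intervals (hi 0 x) (hi x y)
  simp only at h1
  linarith

theorem integral_a_le_sub (h : L.CriticalSolution c f a b w z) {j : E} {x y : ℝ}
    (hx : x ∈ Icc 0 (Γ.len j)) (hy : y ∈ Icc 0 (Γ.len j)) (hxy : x ≤ y) :
    ∫ r in x..y, a j r ≤ f (Γ.param j y) - f (Γ.param j x) := by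
  have hi : ∀ p q, IntervalIntegrable (a j) volume p q := fun p q =>
    (h.segment j).continuous_a.intervalIntegrable p q
  have h1 := (h.segment j).monotoneOn hx hy hxy
  have h2 := intervalIntegral.integral_add_adjacent_intervals (hi 0 x) (hi x y)
  simp only at h1
  linarith

theorem sub_le_max (h : L.CriticalSolution c f a b w z) {j : E} {x y : ℝ}
    (hx : x ∈ Icc 0 (Γ.len j)) (hy : y ∈ Icc 0 (Γ.len j)) :
    f (Γ.param j y) - f (Γ.param j x) ≤ max (∫ r in x..y, b j r) (∫ r in x..y, a j r) := by
  rcases le_total x y with hxy | hxy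
  · exact (h.sub_le_integral_b hx hy hxy).trans (le_max_left _ _)
  · refine le_trans ?_ (le_max_right _ _)
    have := h.integral_a_le_sub hy hx hxy
    rw [intervalIntegral.integral_symm]
    linarith

/-- The critical slopes are bounded on every edge, so `f` is Lipschitz. -/
theorem exists_lipschitzWith [Finite E] (h : L.CriticalSolution c f a b w z) :
    ∃ K, LipschitzWith K f := by
  have hb : ∀ j, ∃ M : ℝ, ∀ x ∈ Icc 0 (Γ.len j), ‖a j x‖ ≤ M ∧ ‖b j x‖ ≤ M := fun j => by
    obtain ⟨M, hM⟩ := isCompact_Icc.exists_bound_of_continuousOn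
      (((h.segment j).continuous_a.prodMk (h.segment j).continuous_b).continuousOn
        (s := Icc 0 (Γ.len j)))
    exact ⟨M, fun x hx => ⟨(norm_fst_le _).trans (hM x hx), (norm_snd_le _).trans (hM x hx)⟩⟩
  choose M hM using hb
  obtain ⟨K, hK⟩ := (finite_range fun j => (M j).toNNReal).bddAbove
  have hMK : ∀ j, M j ≤ K := fun j => (Real.le_coe_toNNReal _).trans (hK ⟨j, rfl⟩)
  refine ⟨K, lipschitzWith_of_edges fun j => ?_⟩
  have hlt : ∀ x ∈ Icc 0 (Γ.len j), ∀ y ∈ Icc 0 (Γ.len j), x ≤ y →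
      |f (Γ.param j y) - f (Γ.param j x)| ≤ K * |y - x| := by
    intro x hx y hy hxy
    have hI : ∀ t ∈ uIoc x y, t ∈ Icc 0 (Γ.len j) := fun t ht => by
      rw [uIoc_of_le hxy] at ht
      exact ⟨hx.1.trans ht.1.le, ht.2.trans hy.2⟩
    have h1 := intervalIntegral.norm_integral_le_of_norm_le_const
      fun t ht => ((hM j t (hI t ht)).2.trans (hMK j))
    have h2 := intervalIntegral.norm_integral_le_of_norm_le_const
      fun t ht => ((hM j t (hI t ht)).1.trans (hMK j))
    have h3 := h.sub_le_integral_b hx hy hxy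
    have h4 := h.integral_a_le_sub hx hy hxy
    exact abs_le.2 ⟨by linarith [(abs_le.1 h2).1], by linarith [(abs_le.1 h1).2]⟩
  intro x hx y hy
  rcases le_total x y with hxy | hxy
  · rw [abs_sub_comm, abs_sub_comm x]
    exact hlt x hx y hy hxy
  · exact hlt y hy x hx hxy

/-- The chain rule inequality behind domination, at a time spent inside an edge. -/
theorem deriv_le_of_interior (h : L.CriticalSolution c f a b w z) {γ : ℝ → Γ.Point} {κ : ℝ → ℝ}
    {j : E} {t : ℝ} (hγ : ∀ᶠ s in 𝓝 t, κ s ∈ Ioo 0 (Γ.len j) ∧ γ s = Γ.param j (κ s))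
    (hκ : DifferentiableAt ℝ κ t) (hf : DifferentiableAt ℝ (fun s => f (γ s)) t) :
    deriv (fun s => f (γ s)) t ≤ L.along γ t + c := by
  have ht := hγ.self_of_nhds
  have hIcc : Ioo 0 (Γ.len j) ⊆ Icc 0 (Γ.len j) := Ioo_subset_Icc_self
  rw [along_interior ht.1 hγ hκ.hasDerivAt, ← L.edge_of_mem (hIcc ht.1)]
  have hprim : ∀ p : ℝ → ℝ, Continuous p →
      HasDerivAt (fun s => ∫ r in κ t..κ s, p r) (p (κ t) * deriv κ t) t := fun p hp =>
    ((hp.integral_hasStrictDerivAt (κ t) (κ t)).hasDerivAt).comp t hκ.hasDerivAt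
  have hA := hasDerivAt_iff_tendsto_slope.1 (hprim _ (h.segment j).continuous_a)
  have hB := hasDerivAt_iff_tendsto_slope.1 (hprim _ (h.segment j).continuous_b)
  have hF := hasDerivAt_iff_tendsto_slope.1 hf.hasDerivAt
  have hle : 𝓝[>] t ≤ 𝓝[≠] t := nhdsWithin_mono _ fun s hs => (ne_of_gt hs)
  refine le_trans (le_of_tendsto_of_tendsto (hF.mono_left hle)
    ((hB.max hA).mono_left hle) ?_) (max_le ((h.slopes j).b_mul_le _ _)
      ((h.slopes j).a_mul_le _ _))
  filter_upwards [self_mem_nhdsWithin, nhdsWithin_le_nhds hγ] with s hs hγs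
  have hst : 0 < s - t := sub_pos.2 hs
  simp only [slope_def_field, intervalIntegral.integral_same, sub_zero]
  rw [max_div_div_right hst.le, hγs.2, ht.2]
  gcongr
  exact h.sub_le_max (hIcc ht.1) (hIcc hγs.1)

/-- At a vertex the distance to the vertex along the curve is minimal, hence stationary, and so is
`f`, which is Lipschitz. -/
theorem deriv_eq_zero_of_vertex {K : NNReal} (hK : LipschitzWith K f) {γ : ℝ → Γ.Point} {t : ℝ}
    (hd : DifferentiableAt ℝ (fun s => dist (γ t) (γ s)) t) : deriv (fun s => f (γ s)) t = 0 := by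
  have h0 : HasDerivAt (fun s => dist (γ t) (γ s)) 0 t := by
    have hmin : IsLocalMin (fun s => dist (γ t) (γ s)) t :=
      Eventually.of_forall fun s => by simp
    rw [← hmin.deriv_eq_zero]
    exact hd.hasDerivAt
  refine HasDerivAt.deriv ?_
  rw [hasDerivAt_iff_isLittleO] at h0 ⊢
  refine Asymptotics.IsBigO.trans_isLittleO (Asymptotics.IsBigO.of_bound K ?_) h0
  refine Eventually.of_forall fun s => ?_
  have := hK.dist_le_mul (γ s) (γ t)
  simp only [smul_zero, sub_zero, dist_self]
  rwa [Real.norm_of_nonneg dist_nonneg, dist_comm (γ t)]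

theorem deriv_le_of_differentiableAt [Finite E] (h : L.CriticalSolution c f a b w z)
    {K : NNReal} (hK : LipschitzWith K f) {γ : ℝ → Γ.Point} {t : ℝ} (hγ : ContinuousAt γ t)
    {F : E → Γ.Point → ℝ} (hF : ∀ j, ∀ x ∈ Icc 0 (Γ.len j), F j (Γ.param j x) = x)
    (h1 : ∀ j, DifferentiableAt ℝ (fun s => F j (γ s)) t)
    (h2 : ∀ e : V, DifferentiableAt ℝ (fun s => dist (Point.vertex e : Γ.Point) (γ s)) t)
    (h3 : DifferentiableAt ℝ (fun s => f (γ s)) t) :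
    deriv (fun s => f (γ s)) t ≤ L.along γ t + c := by
  rcases hp : γ t with e | ⟨j, x⟩
  · rw [deriv_eq_zero_of_vertex hK (by rw [hp]; exact h2 e), along, hp]
    exact h.rest_nonneg e
  · refine h.deriv_le_of_interior (j := j) (κ := fun s => F j (γ s)) ?_ (h1 j) h3
    have hopen : Γ.param j '' Ioo 0 (Γ.len j) ∈ 𝓝 (γ t) :=
      (isOpen_edge j).mem_nhds ⟨x, x.2, by rw [hp]; exact param_interior Γ j x⟩
    filter_upwards [hγ hopen] with s hs
    obtain ⟨y, hy, e⟩ := hs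
    rw [← e, hF j y (Ioo_subset_Icc_self hy)]
    exact ⟨hy, rfl⟩

/-- Almost everywhere along a curve the derivative of `f` is at most the integrand of the action
plus `c`. -/
theorem ae_deriv_le [Finite V] [Finite E] (h : L.CriticalSolution c f a b w z) {γ : ℝ → Γ.Point}
    {s t : ℝ} (hst : s ≤ t) (hγ : AbsolutelyContinuousOnInterval γ s t) :
    ∀ᵐ τ, τ ∈ Ioo s t → deriv (fun σ => f (γ σ)) τ ≤ L.along γ τ + c := by
  obtain ⟨K, hK⟩ := h.exists_lipschitzWith
  choose M F hF hFa using fun j : E => exists_lipschitz_coord (Γ := Γ) j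
  have hFd : ∀ᵐ τ, ∀ j, τ ∈ uIcc s t → DifferentiableAt ℝ (fun σ => F j (γ σ)) τ :=
    ae_all_iff.2 fun j => ((hF j).comp_absolutelyContinuousOnInterval hγ).ae_differentiableAt
  have hVd : ∀ᵐ τ, ∀ e : V, τ ∈ uIcc s t →
      DifferentiableAt ℝ (fun σ => dist (Point.vertex e : Γ.Point) (γ σ)) τ :=
    ae_all_iff.2 fun e => ((LipschitzWith.dist_right
      (Point.vertex e : Γ.Point)).comp_absolutelyContinuousOnInterval hγ).ae_differentiableAt
  have hfd := (hK.comp_absolutelyContinuousOnInterval hγ).ae_differentiableAt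
  filter_upwards [hFd, hVd, hfd] with τ h1 h2 h3 hτ
  have hτ' : τ ∈ uIcc s t := by
    rw [uIcc_of_le hst]
    exact Ioo_subset_Icc_self hτ
  have hcont : ContinuousAt γ τ := by
    have hd := ((LipschitzWith.dist_left (γ τ)).comp_absolutelyContinuousOnInterval
      hγ).continuousOn.continuousAt (x := τ)
      (by rw [uIcc_of_le hst]; exact Icc_mem_nhds hτ.1 hτ.2)
    rw [ContinuousAt, dist_self] at hd
    exact tendsto_iff_dist_tendsto_zero.2 hd
  exact h.deriv_le_of_differentiableAt hK hcont hFa (fun j => h1 j hτ') (fun e => h2 e hτ')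
    (h3 hτ')

/-- The domination inequality along an arbitrary curve of finite action. -/
theorem sub_le_action [Finite V] [Finite E] (h : L.CriticalSolution c f a b w z)
    {γ : ℝ → Γ.Point} {s t : ℝ} (hst : s ≤ t) (hγ : L.FiniteAction γ s t) :
    f (γ t) - f (γ s) ≤ L.action γ s t + c * (t - s) := by
  obtain ⟨K, hK⟩ := h.exists_lipschitzWith
  have hfc := hK.comp_absolutelyContinuousOnInterval hγ.1
  have hci : IntervalIntegrable (fun _ => c) volume s t := intervalIntegrable_const
  have e1 : f (γ t) - f (γ s) = ∫ τ in s..t, deriv (fun τ => f (γ τ)) τ :=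
    hfc.integral_deriv_eq_sub.symm
  have e2 : L.action γ s t + c * (t - s) = ∫ τ in s..t, (L.along γ τ + c) := by
    rw [intervalIntegral.integral_add hγ.2 hci, intervalIntegral.integral_const, smul_eq_mul,
      mul_comm c]
    rfl
  rw [e1, e2]
  refine intervalIntegral.integral_mono_ae_restrict hst hfc.intervalIntegrable_deriv
    (hγ.2.add hci) ?_
  rw [← restrict_Ioo_eq_restrict_Icc]
  exact (ae_restrict_iff' measurableSet_Ioo).2 (h.ae_deriv_le hst hγ.1)

theorem minAction_bddBelow [Finite V] [Finite E] (h : L.CriticalSolution c f a b w z) {t : ℝ}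
    (ht : 0 ≤ t) (x y : Γ.Point) : f y - f x - c * t ∈ lowerBounds
      {A : ℝ | ∃ γ : ℝ → Γ.Point, L.FiniteAction γ 0 t ∧ γ 0 = x ∧ γ t = y ∧
        A = L.action γ 0 t} := by
  rintro A ⟨γ, hγ, rfl, rfl, rfl⟩
  have := h.sub_le_action ht hγ
  linarith

theorem dominated [Finite V] [Finite E] (h : L.CriticalSolution c f a b w z) :
    L.Dominated c f := by
  intro x y t ht
  obtain ⟨A, γ, hγ, h0, h1⟩ := L.exists_joins x y ht
  have : f y - f x - c * t ≤ L.minAction t x y :=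
    le_csInf ⟨_, γ, hγ.finiteAction ht.le, h0, h1, rfl⟩ (h.minAction_bddBelow ht.le x y)
  linarith

end CriticalSolution

end GraphLagrangian

/-! ### From viscosity solutions to critical slopes -/

namespace CriticalSlopes

variable {ℓ dℓ : ℝ → ℝ → ℝ} {c : ℝ} {a b w z : ℝ → ℝ}

theorem rest_pos_of_lt (h : CriticalSlopes ℓ c a b w z) (hℓ : LineLagrangian ℓ dℓ) {x : ℝ}
    (hab : a x < b x) : 0 < ℓ x 0 + c := by
  refine (h.rest_nonneg x).lt_of_ne fun h0 => hab.ne ?_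
  -- Both lines support `ℓ x + c` at velocity zero, where this function is differentiable.
  have key : ∀ p, (∀ v, p * v ≤ ℓ x v + c) → p = dℓ x 0 := fun p hp => by
    have hmin : IsLocalMin (fun v => ℓ x v - p * v) 0 := Eventually.of_forall fun v => by
      have := hp v
      simp only [mul_zero, sub_zero]
      linarith
    have := hmin.hasDerivAt_eq_zero ((hℓ.hasDerivAt x 0).fun_sub (hasDerivAt_const_mul p))
    linarith
  exact (key _ (h.a_mul_le x)).trans (key _ (h.b_mul_le x)).symm

end CriticalSlopes

namespace GraphLagrangian

open MetricGraph

variable {V E : Type*} {Γ : MetricGraph V E} {L : GraphLagrangian Γ}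

/-- The maximum defining the Hamiltonian is attained. -/
theorem exists_hamiltonian_eq (L : GraphLagrangian Γ) (j : E) {x : ℝ} (hx : x ∈ Icc 0 (Γ.len j))
    (p : ℝ) : ∃ v, -v ∈ inward Γ j x ∧ L.hamiltonian j x p = p * v - L.toFun j x v ∧
      ∀ v', -v' ∈ inward Γ j x → p * v' - L.toFun j x v' ≤ L.hamiltonian j x p := by
  have hcl : IsClosed {v : ℝ | -v ∈ inward Γ j x} := by
    have h0 : IsClosed {v : ℝ | x = 0 → 0 ≤ -v} := by
      by_cases h : x = 0
      · simpa [h] using! isClosed_Iic (a := (0 : ℝ))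
      · simp [h]
    have h1 : IsClosed {v : ℝ | x = Γ.len j → -v ≤ 0} := by
      by_cases h : x = Γ.len j
      · simpa [h] using! isClosed_Ici (a := (0 : ℝ))
      · simp [h]
    exact h0.inter h1
  obtain ⟨v, hv, hmax⟩ := (L.lineLagrangian_edge j).exists_isMaxOn x p hcl
    ⟨0, by simp [inward]⟩
  have hmax' : ∀ v', -v' ∈ inward Γ j x → p * v' - L.toFun j x v' ≤ p * v - L.toFun j x v := by
    intro v' hv'
    have : p * v' - L.edge j x v' ≤ p * v - L.edge j x v := hmax hv'
    rwa [L.edge_of_mem hx, L.edge_of_mem hx] at this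
  have hg : IsGreatest ((fun z => -p * z - L.toFun j x (-z)) '' inward Γ j x)
      (p * v - L.toFun j x v) := by
    refine ⟨⟨-v, hv, by simp⟩, ?_⟩
    rintro _ ⟨z, hz, rfl⟩
    have := hmax' (-z) (by simpa using hz)
    simpa using this
  have e : L.hamiltonian j x p = p * v - L.toFun j x v := hg.csSup_eq
  exact ⟨v, hv, e, fun v' hv' => e ▸ hmax' v' hv'⟩

theorem hamiltonian_lt {j : E} {x p c : ℝ} (hx : x ∈ Icc 0 (Γ.len j))
    (h : ∀ v, -v ∈ inward Γ j x → p * v < L.edge j x v + c) : L.hamiltonian j x p < c := by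
  obtain ⟨v, hv, e, -⟩ := L.exists_hamiltonian_eq j hx p
  have := h v hv
  rw [L.edge_of_mem hx] at this
  linarith

theorem mul_le_of_hamiltonian_le {j : E} {x p c : ℝ} (hx : x ∈ Ioo 0 (Γ.len j))
    (h : L.hamiltonian j x p ≤ c) (v : ℝ) : p * v ≤ L.edge j x v + c := by
  have hx' : x ∈ Icc 0 (Γ.len j) := Ioo_subset_Icc_self hx
  obtain ⟨_, -, -, hmax⟩ := L.exists_hamiltonian_eq j hx' p
  have := hmax v ⟨fun h0 => absurd h0 hx.1.ne', fun h1 => absurd h1 hx.2.ne⟩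
  rw [L.edge_of_mem hx']
  linarith

/-- A function which is a primitive of a continuous `p` along an edge, near a point of this edge, is
`C¹` there with derivative `p`. -/
theorem contDiffWithinAt_of_integral {φ : Γ.Point → ℝ} {j : E} {x : ℝ}
    (hx : x ∈ Icc 0 (Γ.len j)) {p : ℝ → ℝ} (hp : Continuous p)
    (h : ∀ᶠ y in 𝓝[Icc 0 (Γ.len j)] x,
      φ (Γ.param j y) - φ (Γ.param j x) = ∫ r in x..y, p r) :
    ContDiffWithinAt ℝ 1 (φ ∘ Γ.param j) (Icc 0 (Γ.len j)) x ∧ edgeDeriv φ j x = p x := by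
  have hd : ∀ y, HasDerivAt (fun y => φ (Γ.param j x) + ∫ r in x..y, p r) (p y) y := fun y =>
    ((hp.integral_hasStrictDerivAt x y).hasDerivAt).const_add _
  have he : φ ∘ Γ.param j =ᶠ[𝓝[Icc 0 (Γ.len j)] x] fun y => φ (Γ.param j x) + ∫ r in x..y, p r := by
    filter_upwards [h] with y hy
    simp only [Function.comp_apply]
    linarith
  have hC : ContDiff ℝ 1 fun y => φ (Γ.param j x) + ∫ r in x..y, p r := by
    rw [contDiff_one_iff_deriv]
    refine ⟨fun y => (hd y).differentiableAt, ?_⟩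
    rwa [show deriv (fun y => φ (Γ.param j x) + ∫ r in x..y, p r) = p from
      funext fun y => (hd y).deriv]
  refine ⟨hC.contDiffWithinAt.congr_of_eventuallyEq he (by simp), ?_⟩
  rw [edgeDeriv, he.derivWithin_eq (by simp)]
  exact (hd x).hasDerivWithinAt.derivWithin (uniqueDiffOn_Icc (Γ.len_pos j) x hx)

variable {c : ℝ} {f : Γ.Point → ℝ}

/-- A test function on the line, read in the coordinate of an edge, is a test function on the
graph at the interior points of the edge. -/
theorem test_interior {j : E} {Φ ψ : ℝ → ℝ} (hψ : Continuous ψ)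
    (hΦ : ∀ y, HasDerivAt Φ (ψ y) y) {m : ℝ} (hm : m ∈ Ioo 0 (Γ.len j)) :
    C1Near (fun p => Φ (Γ.coord j p)) (Γ.param j m) ∧
      edgeDeriv (fun p => Φ (Γ.coord j p)) j m = ψ m := by
  have hm' : m ∈ Icc 0 (Γ.len j) := Ioo_subset_Icc_self hm
  have key := contDiffWithinAt_of_integral (φ := fun p => Φ (Γ.coord j p)) hm' hψ (by
    filter_upwards [self_mem_nhdsWithin] with y hy
    rw [coord_param j hy, coord_param j hm',
      intervalIntegral.integral_eq_sub_of_hasDerivAt (fun t _ => hΦ t) (hψ.intervalIntegrable _ _)])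
  refine ⟨fun i x hx hxm => ?_, key.2⟩
  obtain ⟨rfl, rfl⟩ := param_eq_param hx hm hxm
  exact key.1

theorem eventually_interior [Finite E] {j : E} {Φ : ℝ → ℝ} {m : ℝ} (hm : m ∈ Ioo 0 (Γ.len j))
    {P : ℝ → Prop} (h : ∀ᶠ y in 𝓝 m, P (f (Γ.param j y) - Φ y)) :
    ∀ᶠ p in 𝓝 (Γ.param j m), P (f p - Φ (Γ.coord j p)) := by
  filter_upwards [eventually_mem_edge hm h] with p hp
  obtain ⟨y, ⟨hy, hyI⟩, rfl⟩ := hp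
  rw [coord_param j (Ioo_subset_Icc_self hyI)]
  exact hy

theorem IsViscositySubsolution.test [Finite E] (hf : L.IsViscositySubsolution c f) {j : E}
    {Φ ψ : ℝ → ℝ} (hψ : Continuous ψ) (hΦ : ∀ y, HasDerivAt Φ (ψ y) y) {m : ℝ}
    (hm : m ∈ Ioo 0 (Γ.len j)) (hmax : IsLocalMax (fun y => f (Γ.param j y) - Φ y) m) (v : ℝ) :
    ψ m * v ≤ L.edge j m v + c := by
  have hm' : m ∈ Icc 0 (Γ.len j) := Ioo_subset_Icc_self hm
  obtain ⟨h1, h2⟩ := test_interior (Γ := Γ) hψ hΦ hm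
  refine mul_le_of_hamiltonian_le hm ?_ v
  rw [← h2]
  refine hf _ _ h1 ?_ j m hm' rfl
  have := eventually_interior (f := f) hm (P := fun r => r ≤ f (Γ.param j m) - Φ m) hmax
  simpa only [IsLocalMax, IsMaxFilter, coord_param j hm'] using this

theorem IsViscositySupersolution.test [Finite E] (hf : L.IsViscositySupersolution c f) {j : E}
    {Φ ψ : ℝ → ℝ} (hψ : Continuous ψ) (hΦ : ∀ y, HasDerivAt Φ (ψ y) y) {m : ℝ}
    (hm : m ∈ Ioo 0 (Γ.len j)) (hmin : IsLocalMin (fun y => f (Γ.param j y) - Φ y) m) :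
    c ≤ L.hamiltonian j m (ψ m) := by
  have hm' : m ∈ Icc 0 (Γ.len j) := Ioo_subset_Icc_self hm
  obtain ⟨h1, h2⟩ := test_interior (Γ := Γ) hψ hΦ hm
  have := eventually_interior (f := f) hm (P := fun r => f (Γ.param j m) - Φ m ≤ r) hmin
  obtain ⟨i, x, hx, hxm, hH⟩ := hf _ _ h1
    (by simpa only [IsLocalMin, IsMinFilter, coord_param j hm'] using this)
  obtain ⟨rfl, rfl⟩ := param_eq_param hx hm hxm
  rwa [h2] at hH

/-- If there is a subsolution, then `L (x, 0) + c ≥ 0`: this holds wherever a test function touches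
from above, hence on a dense set. -/
theorem IsViscositySubsolution.rest_nonneg [Finite E] (hf : L.IsViscositySubsolution c f)
    (hc : Continuous f) (j : E) (x : ℝ) : 0 ≤ L.edge j x 0 + c := by
  have hl := Γ.len_pos j
  have hD : Continuous fun x => L.edge j x 0 + c :=
    ((L.lineLagrangian_edge j).continuous.comp (Continuous.prodMk_left 0)).add continuous_const
  have hIcc : ∀ x ∈ Icc 0 (Γ.len j), 0 ≤ L.edge j x 0 + c := by
    intro x hx
    by_contra! hlt
    have hopen : IsOpen ({x | L.edge j x 0 + c < 0} ∩ Ioo 0 (Γ.len j)) :=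
      (isOpen_lt hD continuous_const).inter isOpen_Ioo
    rw [← closure_Ioo hl.ne] at hx
    obtain ⟨y, hy⟩ := mem_closure_iff.1 hx _ (isOpen_lt hD continuous_const) hlt
    obtain ⟨p, q, hpq, hsub⟩ := mem_nhds_iff_exists_Ioo_subset.1 (hopen.mem_nhds hy)
    obtain ⟨Φ, ψ, hψ, hΦ, m, hm, hmax⟩ := exists_isLocalMax_sub_C1
      (hc.comp (lipschitzWith_param j).continuous) (hpq.1.trans hpq.2)
    have h1 := hf.test hψ hΦ (hsub hm).2 hmax 0
    have h2 : L.edge j m 0 + c < 0 := (hsub hm).1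
    linarith
  have := hIcc _ (Subtype.coe_prop (projIcc 0 (Γ.len j) hl.le x))
  rwa [L.edge_of_mem (Subtype.coe_prop _)] at this

theorem IsViscositySolution.segmentSolution [Finite E] (hf : L.IsViscositySolution c f) {j : E}
    {a b w z : ℝ → ℝ} (h : CriticalSlopes (L.edge j) c a b w z) :
    SegmentSolution (fun x => f (Γ.param j x)) a b (fun x => L.edge j x 0 + c) (Γ.len j) := by
  have hℓ := L.lineLagrangian_edge j
  have hu : Continuous fun x => f (Γ.param j x) := hf.1.comp (lipschitzWith_param j).continuous
  have hprim : ∀ p : ℝ → ℝ, Continuous p →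
      ∀ y, HasDerivAt (fun y => ∫ r in (0 : ℝ)..y, p r) (p y) y :=
    fun p hp y => (hp.integral_hasStrictDerivAt 0 y).hasDerivAt
  have hprimc : ∀ p : ℝ → ℝ, Continuous p → Continuous fun y => ∫ r in (0 : ℝ)..y, p r :=
    fun p hp => continuous_iff_continuousAt.2 fun y => (hprim p hp y).continuousAt
  have htest : ∀ p : ℝ → ℝ, Continuous p → ∀ Φ ψ : ℝ → ℝ, Continuous ψ →
      (∀ y, HasDerivAt Φ (ψ y) y) → ∀ m ∈ Ioo 0 (Γ.len j),
      IsLocalMax (fun y => f (Γ.param j y) - (∫ r in (0 : ℝ)..y, p r) - Φ y) m →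
      ∀ v, (p m + ψ m) * v ≤ L.edge j m v + c := by
    intro p hp Φ ψ hψ hΦ m hm hmax
    refine hf.2.1.test (Φ := fun y => (∫ r in (0 : ℝ)..y, p r) + Φ y) (hp.add hψ)
      (fun y => (hprim p hp y).add (hΦ y)) hm ?_
    simpa only [sub_sub] using hmax
  refine ⟨hu, h.continuous_a, h.continuous_b, (hℓ.continuous.comp
    (Continuous.prodMk_left 0)).add continuous_const, fun x hx =>
      h.a_lt_b hℓ ((h.rest_nonneg x).lt_of_ne' hx), ?_, ?_, ?_⟩
  · refine antitoneOn_of_test (hu.sub (hprimc _ h.continuous_b)) fun Φ ψ hψ hΦ m hm hmax => ?_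
    have := h.le_b m _ (htest b h.continuous_b Φ ψ hψ hΦ m hm hmax)
    linarith
  · refine monotoneOn_of_test (hu.sub (hprimc _ h.continuous_a)) fun Φ ψ hψ hΦ m hm hmax => ?_
    have := h.a_le m _ (htest a h.continuous_a Φ ψ hψ hΦ m hm hmax)
    linarith
  · intro Φ ψ hψ hΦ m hm hmin ham
    by_contra! hmb
    exact absurd (hf.2.2.test hψ hΦ hm hmin) (not_le.2 (hamiltonian_lt (Ioo_subset_Icc_self hm)
      fun v _ => h.mul_lt (h.rest_pos_of_lt hℓ (ham.trans hmb)) ham hmb v))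

/-- A supersolution is not possible at a vertex that belongs to no edge. -/
theorem IsViscositySupersolution.exists_incident (hf : L.IsViscositySupersolution c f) (e : V) :
    ∃ j, ∃ x ∈ Icc 0 (Γ.len j), Γ.param j x = .vertex e := by
  by_contra! h
  obtain ⟨j, x, hx, hxe, -⟩ := hf f (.vertex e) (fun j x hx hxe => absurd hxe (h j x hx))
    (Eventually.of_forall fun y => by simp)
  exact h j x hx hxe

theorem IsViscositySolution.exists_criticalSolution [Finite E]
    (hf : L.IsViscositySolution c f) : ∃ a b w z, L.CriticalSolution c f a b w z := by
  choose a b w z h using fun j =>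
    (L.lineLagrangian_edge j).exists_criticalSlopes (hf.2.1.rest_nonneg hf.1 j)
  have hseg := fun j => hf.segmentSolution (h j)
  have hrest : ∀ e, 0 ≤ L.atRest e + c := fun e => by
    obtain ⟨j, x, hx, hxe⟩ := hf.2.2.exists_incident e
    rw [← L.atRest_eq j x hx e hxe, ← L.edge_of_mem hx]
    exact (h j).rest_nonneg x
  refine ⟨a, b, w, z, h, hseg, hrest, fun e => ?_⟩
  by_contra! hne
  obtain ⟨hne0, hne1⟩ := hne
  have hpos := (hrest e).lt_of_ne' hne0
  have hposj : ∀ j, ∀ x ∈ Icc 0 (Γ.len j), Γ.param j x = .vertex e → 0 < L.edge j x 0 + c :=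
    fun j x hx hxe => by rwa [L.edge_of_mem hx, L.atRest_eq j x hx e hxe]
  -- Otherwise `f` itself is a test function at `e`, and its slopes are those of departing motions.
  have key : ∀ j, ∀ x ∈ Icc 0 (Γ.len j), Γ.param j x = .vertex e →
      ContDiffWithinAt ℝ 1 (f ∘ Γ.param j) (Icc 0 (Γ.len j)) x ∧
        L.hamiltonian j x (edgeDeriv f j x) < c := by
    intro j x hx hxe
    have hl := Γ.len_pos j
    have hD := hposj j x hx hxe
    rcases param_eq_vertex hx hxe with ⟨rfl, hs⟩ | ⟨rfl, ht⟩
    · rcases (hseg j).critical_interval_left_end hl.le with ⟨y, hy, hy0, hya⟩ | ⟨m, hm, hmb⟩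
      · obtain ⟨t, ht, t', ht', hne⟩ := (hne1 j).2 hs y hy hy0
        exact absurd (hya t ht t' ht') hne
      · obtain ⟨h1, h2⟩ := contDiffWithinAt_of_integral (φ := f) hx (h j).continuous_b (by
          filter_upwards [self_mem_nhdsWithin, nhdsWithin_le_nhds (Iio_mem_nhds hm.1)] with y hy hym
          exact hmb 0 ⟨le_rfl, hm.1.le⟩ y ⟨hy.1, le_of_lt hym⟩)
        refine ⟨h1, h2 ▸ hamiltonian_lt hx fun v hv => ?_⟩
        exact (h j).b_mul_lt (L.lineLagrangian_edge j) hD (by linarith [hv.1 rfl])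
    · rcases (hseg j).critical_interval_right_end hl.le with ⟨y, hy, hy0, hyb⟩ | ⟨m, hm, hma⟩
      · obtain ⟨t, ht', t', ht'', hne⟩ := (hne1 j).1 ht y hy hy0
        exact absurd (hyb t ht' t' ht'') hne
      · obtain ⟨h1, h2⟩ := contDiffWithinAt_of_integral (φ := f) hx (h j).continuous_a (by
          filter_upwards [self_mem_nhdsWithin, nhdsWithin_le_nhds (Ioi_mem_nhds hm.2)] with y hy hym
          exact hma _ ⟨hm.2.le, le_rfl⟩ y ⟨le_of_lt hym, hy.2⟩)
        refine ⟨h1, h2 ▸ hamiltonian_lt hx fun v hv => ?_⟩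
        exact (h j).a_mul_lt (L.lineLagrangian_edge j) hD (by linarith [hv.2 rfl])
  obtain ⟨j, x, hx, hxe, hH⟩ := hf.2.2 f (.vertex e) (fun j x hx hxe => (key j x hx hxe).1)
    (Eventually.of_forall fun y => by simp)
  exact absurd hH (not_le.2 (key j x hx hxe).2)

end GraphLagrangian

/-! ### Backward motions with the critical speeds -/

/-- Run backwards from `x` with a nonnegative speed, for a unit of time or until `y` is reached. -/
theorem exists_backward_motion {w : ℝ → ℝ} (hw : Continuous w) (h0 : ∀ x, 0 ≤ w x) {W : ℝ}
    (hW : ∀ x, w x ≤ W) {x y : ℝ} (hyx : y ≤ x) :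
    ∃ (κ : ℝ → ℝ) (T : ℝ), T ∈ Icc 0 1 ∧ κ 0 = x ∧ (∀ t, HasDerivAt κ (w (κ t)) t) ∧
      (∀ t ∈ Icc (-T) 0, κ t ∈ Icc y x) ∧ (T = 1 ∨ κ (-T) = y) ∧ x - κ (-T) ≤ W * T := by
  obtain ⟨κ, hκ0, hκ⟩ := exists_hasDerivAt_of_continuous_nonneg hw h0 hW x
  have hm : Monotone κ := monotone_of_deriv_nonneg (fun t => (hκ t).differentiableAt) fun t => by
    rw [(hκ t).deriv]
    exact h0 _
  have hc : Continuous κ := continuous_iff_continuousAt.2 fun t => (hκ t).continuousAt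
  obtain ⟨T, hT, hy, hTy⟩ : ∃ T ∈ Icc (0 : ℝ) 1, y ≤ κ (-T) ∧ (T = 1 ∨ κ (-T) = y) := by
    rcases le_total y (κ (-1)) with h | h
    · exact ⟨1, ⟨zero_le_one, le_rfl⟩, h, Or.inl rfl⟩
    · obtain ⟨t, ht, hty⟩ := intermediate_value_Icc (show (-1 : ℝ) ≤ 0 by norm_num)
        hc.continuousOn ⟨h, hκ0 ▸ hyx⟩
      exact ⟨-t, ⟨by linarith [ht.2], by linarith [ht.1]⟩, by simp [hty], Or.inr (by simp [hty])⟩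
  refine ⟨κ, T, hT, hκ0, hκ, fun t ht => ⟨hy.trans (hm ht.1), hκ0 ▸ hm ht.2⟩, hTy, ?_⟩
  have := convex_univ.norm_image_sub_le_of_norm_hasDerivWithin_le (C := W)
    (fun t _ => (hκ t).hasDerivWithinAt)
    (fun t _ => (Real.norm_of_nonneg (h0 _)).trans_le (hW _)) (mem_univ (-T)) (mem_univ 0)
  rw [hκ0, Real.norm_eq_abs, Real.norm_eq_abs, zero_sub, neg_neg, abs_of_nonneg hT.1] at this
  exact (le_abs_self _).trans this

theorem exists_backward_motion_of_nonpos {z : ℝ → ℝ} (hz : Continuous z) (h0 : ∀ x, z x ≤ 0)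
    {W : ℝ} (hW : ∀ x, -W ≤ z x) {x y : ℝ} (hxy : x ≤ y) :
    ∃ (κ : ℝ → ℝ) (T : ℝ), T ∈ Icc 0 1 ∧ κ 0 = x ∧ (∀ t, HasDerivAt κ (z (κ t)) t) ∧
      (∀ t ∈ Icc (-T) 0, κ t ∈ Icc x y) ∧ (T = 1 ∨ κ (-T) = y) ∧ κ (-T) - x ≤ W * T := by
  obtain ⟨κ, T, hT, hκ0, hκ, hI, hTy, hb⟩ := exists_backward_motion (w := fun x => -z (-x))
    (by fun_prop) (fun x => by linarith [h0 (-x)]) (W := W) (fun x => by linarith [hW (-x)])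
    (neg_le_neg hxy)
  refine ⟨fun t => -κ t, T, hT, by simp [hκ0], fun t => ?_, fun t ht => ?_, ?_, by linarith⟩
  · simpa using! (hκ t).neg
  · have := hI t ht
    exact ⟨by linarith [this.2], by linarith [this.1]⟩
  · exact hTy.imp id fun h => by linarith

namespace GraphLagrangian

open MetricGraph

variable {V E : Type*} {Γ : MetricGraph V E} {L : GraphLagrangian Γ}

theorem eval_param {j : E} {x : ℝ} (hx : x ∈ Icc 0 (Γ.len j)) :
    L.eval (Γ.param j x) 0 = L.edge j x 0 := by
  rw [L.edge_of_mem hx]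
  rcases h : Γ.param j x with e | ⟨i, y⟩
  · exact (L.atRest_eq j x hx e h).symm
  · rw [← param_interior Γ i y] at h
    obtain ⟨rfl, rfl⟩ := param_eq_param hx y.2 h
    rfl

/-- The point `x` is reached from `y` in time `T` by a Lipschitz curve calibrating `f`. -/
def CalibratedJoin (L : GraphLagrangian Γ) (c : ℝ) (f : Γ.Point → ℝ) (T : ℝ) (y x : Γ.Point) :
    Prop :=
  L.Joins T (f x - f y - c * T) y x

variable {c : ℝ} {f : Γ.Point → ℝ}

theorem CalibratedJoin.trans {T S : ℝ} {x y z : Γ.Point} (h : L.CalibratedJoin c f T x y)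
    (h' : L.CalibratedJoin c f S y z) (hT : 0 ≤ T) (hS : 0 ≤ S) :
    L.CalibratedJoin c f (T + S) x z := by
  have := Joins.trans h h' hT hS
  rwa [show f y - f x - c * T + (f z - f y - c * S) = f z - f x - c * (T + S) by ring] at this

theorem calibratedJoin_refl {x : Γ.Point} (hx : L.eval x 0 + c = 0) (T : ℝ) :
    L.CalibratedJoin c f T x x := by
  have := L.joins_refl x T
  rwa [show T * L.eval x 0 = f x - f x - c * T by rw [eq_neg_of_add_eq_zero_left hx]; ring] at this

/-- Motions on an edge with the speed `v` attached to the slope `p` calibrate the functions with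
slope `p`. -/
theorem calibratedJoin_of_motion {j : E} {p v κ : ℝ → ℝ} {T W : ℝ} (hT : 0 ≤ T)
    (hp : Continuous p) (hv : Continuous v) (hW : ∀ x, ‖v x‖ ≤ W)
    (hpv : ∀ x ∈ Icc 0 (Γ.len j), p x * v x = L.edge j x (v x) + c)
    (hκ : ∀ t, HasDerivAt κ (v (κ t)) t) (hκI : ∀ t ∈ Icc (-T) 0, κ t ∈ Icc 0 (Γ.len j))
    (hf : f (Γ.param j (κ 0)) - f (Γ.param j (κ (-T))) = ∫ r in κ (-T)..κ 0, p r) :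
    L.CalibratedJoin c f T (Γ.param j (κ (-T))) (Γ.param j (κ 0)) := by
  set μ : ℝ → ℝ := fun t => κ (t - T) with hμ
  have hd : ∀ t, HasDerivAt μ (v (μ t)) t := fun t => (hκ (t - T)).comp_sub_const t T
  have hμI : ∀ t ∈ Icc 0 T, μ t ∈ Icc 0 (Γ.len j) := fun t ht =>
    hκI _ ⟨by linarith [ht.1], by linarith [ht.2]⟩
  have hμc : Continuous μ := continuous_iff_continuousAt.2 fun t => (hd t).continuousAt
  have hvμ : Continuous fun t => v (μ t) := hv.comp hμc
  have hW0 : 0 ≤ W := (norm_nonneg _).trans (hW 0)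
  have hlip : LipschitzWith ⟨W, hW0⟩ μ := LipschitzWith.of_dist_le_mul fun x y =>
    convex_univ.norm_image_sub_le_of_norm_hasDerivWithin_le (C := W)
      (fun t _ => (hd t).hasDerivWithinAt) (fun t _ => hW _) (mem_univ y) (mem_univ x)
  have hg : Continuous fun t => L.edge j (μ t) (v (μ t)) :=
    (L.lineLagrangian_edge j).continuous.comp (hμc.prodMk hvμ)
  have hact := hasAction_param (L := L) (κ' := fun t => v (μ t)) hT hlip.lipschitzOnWith hμI
    (fun t _ => hd t) hg fun t ht => (L.edge_of_mem (hμI t (Ioo_subset_Icc_self ht)) _).symm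
  have hint : ∫ t in (0 : ℝ)..T, L.edge j (μ t) (v (μ t)) =
      f (Γ.param j (κ 0)) - f (Γ.param j (κ (-T))) - c * T := by
    have e1 : ∫ t in (0 : ℝ)..T, L.edge j (μ t) (v (μ t)) =
        ∫ t in (0 : ℝ)..T, (p (μ t) * v (μ t) - c) := by
      refine intervalIntegral.integral_congr fun t ht => ?_
      rw [uIcc_of_le hT] at ht
      have := hpv _ (hμI t ht)
      linarith
    have e2 : ∫ t in (0 : ℝ)..T, p (μ t) * v (μ t) = ∫ r in μ 0..μ T, p r := by
      simpa using intervalIntegral.integral_comp_mul_deriv (fun t _ => hd t) hvμ.continuousOn hp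
    have hi : IntervalIntegrable (fun t => p (μ t) * v (μ t)) volume 0 T :=
      ((hp.comp hμc).mul hvμ).intervalIntegrable _ _
    rw [e1, intervalIntegral.integral_sub hi intervalIntegrable_const, e2,
      intervalIntegral.integral_const, hf]
    simp [hμ, mul_comm]
  rw [hint] at hact
  exact ⟨_, hact, by simp [hμ], by simp [hμ]⟩

namespace CriticalSolution

variable {a b w z : E → ℝ → ℝ}

theorem exists_speed_bound [Finite E] (h : L.CriticalSolution c f a b w z) :
    ∃ W > 0, ∀ j, ∀ x ∈ Icc 0 (Γ.len j), w j x ≤ W ∧ -W ≤ z j x := by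
  have hb : ∀ j, ∃ M : ℝ, ∀ x ∈ Icc 0 (Γ.len j), ‖(w j x, z j x)‖ ≤ M := fun j =>
    isCompact_Icc.exists_bound_of_continuousOn
      ((h.slopes j).continuous_w.prodMk (h.slopes j).continuous_z).continuousOn
  choose M hM using hb
  obtain ⟨W, hW⟩ := (finite_range M).bddAbove
  refine ⟨max W 1, by positivity, fun j x hx => ?_⟩
  have h1 : M j ≤ max W 1 := (hW ⟨j, rfl⟩).trans (le_max_left _ _)
  have h2 := (le_abs_self _).trans ((norm_fst_le _).trans ((hM j x hx).trans h1))
  have h3 := (norm_snd_le _).trans ((hM j x hx).trans h1)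
  exact ⟨h2, (abs_le.1 h3).1⟩

/-- Where `f` has slope `b`, it is calibrated by a motion from the left, which lasts for a unit of
time or starts at the vertex `src j`. -/
theorem arrive_from_left (h : L.CriticalSolution c f a b w z) {W : ℝ}
    (hW : ∀ j, ∀ x ∈ Icc 0 (Γ.len j), w j x ≤ W ∧ -W ≤ z j x) {j : E} {x y : ℝ}
    (hx : x ≤ Γ.len j) (hy : y ∈ Icc 0 x) (hy0 : y = 0 ∨ L.edge j y 0 + c = 0)
    (hb : ∀ t ∈ Icc y x, ∀ t' ∈ Icc y x,
      f (Γ.param j t') - f (Γ.param j t) = ∫ r in t..t', b j r) :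
    (∃ q, ∃ T ≥ 1, L.CalibratedJoin c f T q (Γ.param j x)) ∨
      ∃ T ≥ 0, x ≤ W * T ∧ L.CalibratedJoin c f T (.vertex (Γ.src j)) (Γ.param j x) := by
  have hl := (Γ.len_pos j).le
  set v : ℝ → ℝ := fun x => w j (projIcc 0 (Γ.len j) hl x) with hv
  have hvc : Continuous v :=
    (h.slopes j).continuous_w.comp (continuous_subtype_val.comp continuous_projIcc)
  have hv0 : ∀ x, 0 ≤ v x := fun x => (h.slopes j).w_nonneg _
  have hvW : ∀ x, v x ≤ W := fun x => (hW j _ (Subtype.coe_prop _)).1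
  obtain ⟨κ, T, hT, rfl, hκ, hκI, hend, hdist⟩ := exists_backward_motion hvc hv0 hvW hy.2
  have hI : ∀ t ∈ Icc (-T) 0, κ t ∈ Icc 0 (Γ.len j) := fun t ht =>
    ⟨hy.1.trans (hκI t ht).1, (hκI t ht).2.trans hx⟩
  have hT0 : -T ≤ 0 := by linarith [hT.1]
  have hcal := calibratedJoin_of_motion (L := L) (c := c) (f := f) hT.1
    (h.slopes j).continuous_b hvc (W := W)
    (fun x => by rw [Real.norm_of_nonneg (hv0 x)]; exact hvW x)
    (fun x hx => by simp only [hv, projIcc_of_mem _ hx]; exact (h.slopes j).b_mul_w x) hκ hI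
    (hb _ (hκI _ ⟨le_rfl, hT0⟩) _ (hκI _ ⟨hT0, le_rfl⟩))
  rcases hend with h1 | h1
  · exact Or.inl ⟨_, T, h1.ge, hcal⟩
  rw [h1] at hcal hdist
  rcases hy0 with rfl | hy0
  · rw [param_zero] at hcal
    exact Or.inr ⟨T, hT.1, by linarith, hcal⟩
  · have := calibratedJoin_refl (L := L) (f := f) (c := c)
      (by rwa [eval_param ⟨hy.1, hy.2.trans hx⟩]) 1
    exact Or.inl ⟨_, 1 + T, by linarith [hT.1], this.trans hcal zero_le_one hT.1⟩

/-- Where `f` has slope `a`, it is calibrated by a motion from the right, which lasts for a unit of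
time or starts at the vertex `tgt j`. -/
theorem arrive_from_right (h : L.CriticalSolution c f a b w z) {W : ℝ}
    (hW : ∀ j, ∀ x ∈ Icc 0 (Γ.len j), w j x ≤ W ∧ -W ≤ z j x) {j : E} {x y : ℝ}
    (hx : 0 ≤ x) (hy : y ∈ Icc x (Γ.len j)) (hy0 : y = Γ.len j ∨ L.edge j y 0 + c = 0)
    (ha : ∀ t ∈ Icc x y, ∀ t' ∈ Icc x y,
      f (Γ.param j t') - f (Γ.param j t) = ∫ r in t..t', a j r) :
    (∃ q, ∃ T ≥ 1, L.CalibratedJoin c f T q (Γ.param j x)) ∨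
      ∃ T ≥ 0, Γ.len j - x ≤ W * T ∧
        L.CalibratedJoin c f T (.vertex (Γ.tgt j)) (Γ.param j x) := by
  have hl := (Γ.len_pos j).le
  set v : ℝ → ℝ := fun x => z j (projIcc 0 (Γ.len j) hl x) with hv
  have hvc : Continuous v :=
    (h.slopes j).continuous_z.comp (continuous_subtype_val.comp continuous_projIcc)
  have hv0 : ∀ x, v x ≤ 0 := fun x => (h.slopes j).z_nonpos _
  have hvW : ∀ x, -W ≤ v x := fun x => (hW j _ (Subtype.coe_prop _)).2
  obtain ⟨κ, T, hT, rfl, hκ, hκI, hend, hdist⟩ := exists_backward_motion_of_nonpos hvc hv0 hvW hy.1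
  have hI : ∀ t ∈ Icc (-T) 0, κ t ∈ Icc 0 (Γ.len j) := fun t ht =>
    ⟨hx.trans (hκI t ht).1, (hκI t ht).2.trans hy.2⟩
  have hT0 : -T ≤ 0 := by linarith [hT.1]
  have hcal := calibratedJoin_of_motion (L := L) (c := c) (f := f) hT.1
    (h.slopes j).continuous_a hvc (W := W)
    (fun x => by rw [Real.norm_of_nonpos (hv0 x)]; linarith [hvW x])
    (fun x hx => by simp only [hv, projIcc_of_mem _ hx]; exact (h.slopes j).a_mul_z x) hκ hI
    (ha _ (hκI _ ⟨le_rfl, hT0⟩) _ (hκI _ ⟨hT0, le_rfl⟩))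
  rcases hend with h1 | h1
  · exact Or.inl ⟨_, T, h1.ge, hcal⟩
  rw [h1] at hcal hdist
  rcases hy0 with rfl | hy0
  · rw [param_len] at hcal
    exact Or.inr ⟨T, hT.1, hdist, hcal⟩
  · have := calibratedJoin_refl (L := L) (f := f) (c := c)
      (by rwa [eval_param ⟨hx.trans hy.1, hy.2⟩]) 1
    exact Or.inl ⟨_, 1 + T, by linarith [hT.1], this.trans hcal zero_le_one hT.1⟩

/-- Every vertex is reached by calibrated curves of duration at least `1`: crossing an edge takes a
time bounded below. -/
theorem exists_calibratedJoin_vertex [Finite E] (h : L.CriticalSolution c f a b w z) (e : V) :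
    ∃ q, ∃ T ≥ 1, L.CalibratedJoin c f T q (.vertex e) := by
  obtain ⟨W, hW0, hW⟩ := h.exists_speed_bound
  obtain ⟨r, hr, hr0⟩ : ∃ r : ℝ, (∀ j, r < Γ.len j) ∧ r ∈ Ioi (0 : ℝ) := by
    have h : ∀ᶠ r : ℝ in 𝓝[>] 0, ∀ j, r < Γ.len j := eventually_all.2 fun j =>
      nhdsWithin_le_nhds (Iio_mem_nhds (Γ.len_pos j))
    exact (h.and self_mem_nhdsWithin).exists
  have hr0' : 0 < r := hr0
  have step : ∀ e : V, (∃ q, ∃ T ≥ 1, L.CalibratedJoin c f T q (.vertex e)) ∨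
      ∃ e' : V, ∃ T ≥ r / W, L.CalibratedJoin c f T (.vertex e') (.vertex e) := by
    intro e
    have hT : ∀ (j : E) (T : ℝ), Γ.len j ≤ W * T → r / W ≤ T := fun j T hT => by
      rw [div_le_iff₀ hW0]
      linarith [hr j]
    rcases h.arrival e with h0 | ⟨j, ⟨rfl, y, hy, hy0, hb⟩ | ⟨rfl, y, hy, hy0, ha⟩⟩
    · exact Or.inl ⟨_, 1, le_rfl, calibratedJoin_refl h0 1⟩
    · have := h.arrive_from_left hW le_rfl hy hy0 hb
      rw [param_len] at this
      exact this.imp id fun ⟨T, _, hxT, hcal⟩ => ⟨_, T, hT j T hxT, hcal⟩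
    · have := h.arrive_from_right hW le_rfl hy hy0 ha
      rw [param_zero] at this
      exact this.imp id fun ⟨T, _, hxT, hcal⟩ => ⟨_, T, hT j T (by linarith), hcal⟩
  have hrW : 0 < r / W := div_pos hr0' hW0
  have iter : ∀ (n : ℕ) (e : V), ∃ q, ∃ T ≥ 0, (1 ≤ T ∨ n * (r / W) ≤ T) ∧
      L.CalibratedJoin c f T q (.vertex e) := by
    intro n
    induction n with
    | zero =>
      intro e
      rcases step e with ⟨q, T, hT, hcal⟩ | ⟨e', T, hT, hcal⟩
      · exact ⟨q, T, by linarith, Or.inl hT, hcal⟩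
      · exact ⟨_, T, hrW.le.trans hT, Or.inr (by simpa using hrW.le.trans hT), hcal⟩
    | succ n ih =>
      intro e
      rcases step e with ⟨q, T, hT, hcal⟩ | ⟨e', T, hT, hcal⟩
      · exact ⟨q, T, by linarith, Or.inl hT, hcal⟩
      · obtain ⟨q, S, hS, hS1, hcal'⟩ := ih e'
        have hT0 : 0 ≤ T := hrW.le.trans hT
        refine ⟨q, S + T, by linarith, ?_, hcal'.trans hcal hS hT0⟩
        rcases hS1 with hS1 | hS1
        · exact Or.inl (by linarith)
        · refine Or.inr ?_
          push_cast
          linarith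
  obtain ⟨n, hn⟩ := exists_nat_ge (1 / (r / W))
  rw [div_le_iff₀ hrW] at hn
  obtain ⟨q, T, _, hT, hcal⟩ := iter n e
  exact ⟨q, T, hT.elim id hn.trans, hcal⟩

theorem exists_calibratedJoin [Finite E] (h : L.CriticalSolution c f a b w z) (x : Γ.Point) :
    ∃ q, ∃ T ≥ 1, L.CalibratedJoin c f T q x := by
  rcases x with e | ⟨j, x⟩
  · exact h.exists_calibratedJoin_vertex e
  obtain ⟨W, _, hW⟩ := h.exists_speed_bound
  have hx : (x : ℝ) ∈ Icc 0 (Γ.len j) := Ioo_subset_Icc_self x.2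
  rw [← param_interior Γ j x]
  have hvert : ∀ e : V, ∀ T ≥ 0, L.CalibratedJoin c f T (.vertex e) (Γ.param j x) →
      ∃ q, ∃ T ≥ 1, L.CalibratedJoin c f T q (Γ.param j x) := by
    intro e T hT hcal
    obtain ⟨q, S, hS, hcal'⟩ := h.exists_calibratedJoin_vertex e
    exact ⟨q, S + T, by linarith, hcal'.trans hcal (by linarith) hT⟩
  rcases (h.segment j).exists_critical_interval hx with ⟨y, hy, hy0, hb⟩ | ⟨y, hy, hy0, ha⟩
  · exact (h.arrive_from_left hW hx.2 hy hy0 hb).elim id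
      fun ⟨T, hT, _, hcal⟩ => hvert _ T hT hcal
  · exact (h.arrive_from_right hW hx.1 hy hy0 ha).elim id
      fun ⟨T, hT, _, hcal⟩ => hvert _ T hT hcal

/-- A calibrated curve is calibrated on subintervals: domination holds on each piece, and there is
equality for the sum. -/
theorem calibrated_mono [Finite V] [Finite E] (h : L.CriticalSolution c f a b w z)
    {γ : ℝ → Γ.Point} {s s' t' t : ℝ} (hs : s ≤ s') (hst : s' ≤ t') (ht : t' ≤ t)
    (hγ : L.HasAction γ s t (f (γ t) - f (γ s) - c * (t - s))) :
    L.HasAction γ s' t' (f (γ t') - f (γ s') - c * (t' - s')) := by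
  have hsub : ∀ p q, s ≤ p → p ≤ q → q ≤ t → L.HasAction γ p q (L.action γ p q) := by
    intro p q hp hpq hq
    have hI : Icc p q ⊆ Icc s t := Icc_subset_Icc hp hq
    refine ⟨hγ.1.imp fun K hK => hK.mono hI, hγ.2.1.mono_set ?_, rfl⟩
    rwa [uIcc_of_le hpq, uIcc_of_le (hp.trans (hpq.trans hq))]
  have h1 := hsub s s' le_rfl hs (hst.trans ht)
  have h2 := hsub s' t' hs hst ht
  have h3 := hsub t' t (hs.trans hst) ht le_rfl
  have e := ((h1.trans h2 hs hst).trans h3 (hs.trans hst) ht).2.2.symm.trans hγ.2.2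
  have d1 := h.sub_le_action hs (h1.finiteAction hs)
  have d2 := h.sub_le_action hst (h2.finiteAction hst)
  have d3 := h.sub_le_action ht (h3.finiteAction ht)
  have : L.action γ s' t' = f (γ t') - f (γ s') - c * (t' - s') := by linarith
  rwa [this] at h2

theorem exists_unit_calibrated [Finite V] [Finite E] (h : L.CriticalSolution c f a b w z)
    (x : Γ.Point) : ∃ η : ℝ → Γ.Point, η 0 = x ∧
      L.HasAction η (-1) 0 (f (η 0) - f (η (-1)) - c * (0 - (-1))) := by
  obtain ⟨q, T, hT, γ, hγ, rfl, rfl⟩ := h.exists_calibratedJoin x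
  have h1 : L.HasAction γ 0 T (f (γ T) - f (γ 0) - c * (T - 0)) := by simpa using hγ
  have h2 := h.calibrated_mono (s' := T - 1) (t' := T) (by linarith) (by linarith) le_rfl h1
  refine ⟨fun τ => γ (τ + T), by simp, HasAction.comp_add T ?_⟩
  convert h2 using 1 <;> ring_nf

/-- Gluing calibrated curves of unit duration gives one defined on `(-∞, 0]`. -/
theorem exists_calibratesPast [Finite V] [Finite E] (h : L.CriticalSolution c f a b w z)
    (x : Γ.Point) : ∃ γ : ℝ → Γ.Point, γ 0 = x ∧
      ∀ s t, s ≤ t → t ≤ 0 → L.HasAction γ s t (f (γ t) - f (γ s) - c * (t - s)) := by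
  choose η hη0 hη using h.exists_unit_calibrated
  set X : ℕ → Γ.Point := fun n => n.rec x fun _ y => η y (-1) with hX
  set γ : ℝ → Γ.Point := fun t => η (X ⌊-t⌋₊) (t + ⌊-t⌋₊) with hγ
  have hγn : ∀ n : ℕ, γ (-n) = X n := fun n => by
    simp [hγ, hη0]
  have hpiece : ∀ n : ℕ, EqOn (fun τ => η (X n) (τ + n)) γ (Icc (-((n + 1 : ℕ) : ℝ)) (-n)) := by
    intro n τ hτ
    rcases hτ.1.eq_or_lt with rfl | hlt
    · rw [hγn]
      simp [hX]
    · have : ⌊-τ⌋₊ = n := by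
        rw [Nat.floor_eq_iff (by linarith [hτ.2, n.cast_nonneg (α := ℝ)])]
        push_cast at hlt
        exact ⟨by linarith [hτ.2], by linarith⟩
      simp only [hγ, this]
  have hact : ∀ n : ℕ, L.HasAction γ (-n) 0 (f (γ 0) - f (γ (-n)) - c * (0 - -n)) := by
    intro n
    induction n with
    | zero =>
      simp only [Nat.cast_zero, neg_zero, sub_self, mul_zero]
      exact ⟨⟨0, by simp [LipschitzOnWith]⟩, IntervalIntegrable.refl, by simp [action]⟩
    | succ n ih =>
      have h1 : L.HasAction (fun τ => η (X n) (τ + n)) (-((n + 1 : ℕ) : ℝ)) (-n)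
          (f (η (X n) 0) - f (η (X n) (-1)) - c * (0 - (-1))) := by
        refine HasAction.comp_add (n : ℝ) ?_
        have := hη (X n)
        convert this using 1 <;> push_cast <;> ring
      have h2 := (h1.congr (by push_cast; linarith) (hpiece n)).trans ih
        (by push_cast; linarith) (by simp)
      have e : f (η (X n) 0) - f (η (X n) (-1)) - c * (0 - (-1)) +
          (f (γ 0) - f (γ (-n)) - c * (0 - -n)) =
          f (γ 0) - f (γ (-((n + 1 : ℕ) : ℝ))) - c * (0 - -((n + 1 : ℕ) : ℝ)) := by
        rw [hγn, hγn, hη0]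
        have : X (n + 1) = η (X n) (-1) := rfl
        rw [this]
        push_cast
        ring
      rwa [e] at h2
  refine ⟨γ, by simpa [hX] using hγn 0, fun s t hst ht => ?_⟩
  obtain ⟨n, hn⟩ := exists_nat_ge (-s)
  exact h.calibrated_mono (by linarith) hst ht (hact n)

theorem isBackwardWeakKAM [Finite V] [Finite E] (h : L.CriticalSolution c f a b w z) :
    L.IsBackwardWeakKAM c f := by
  obtain ⟨K, hK⟩ := h.exists_lipschitzWith
  refine ⟨hK.continuous, h.dominated, fun x => ?_⟩
  obtain ⟨γ, hγ0, hγ⟩ := h.exists_calibratesPast x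
  refine ⟨γ, hγ0, fun s t hst ht => ⟨(hγ s t hst ht).finiteAction hst, ?_⟩⟩
  rw [(hγ s t hst ht).2.2]
  ring

theorem lax_add [Finite V] [Finite E] (h : L.CriticalSolution c f a b w z) {t : ℝ} (ht : 0 < t)
    (x : Γ.Point) : L.lax t f x + c * t = f x := by
  have hle : ∀ y, f x - c * t ≤ f y + L.minAction t y x := fun y => by
    have := h.dominated y x t ht
    linarith
  obtain ⟨γ, rfl, hγ⟩ := h.exists_calibratesPast x
  have h1 : L.HasAction (fun τ => γ (τ + -t)) 0 t (f (γ 0) - f (γ (-t)) - c * (0 - -t)) :=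
    HasAction.comp_add (-t) (by simpa using hγ (-t) 0 (by linarith) le_rfl)
  have h2 : L.minAction t (γ (-t)) (γ 0) ≤ f (γ 0) - f (γ (-t)) - c * (0 - -t) :=
    csInf_le ⟨_, h.minAction_bddBelow ht.le _ _⟩
      ⟨_, h1.finiteAction ht.le, by simp, by simp, h1.2.2.symm⟩
  have h3 : L.lax t f (γ 0) ≤ f (γ (-t)) + L.minAction t (γ (-t)) (γ 0) :=
    ciInf_le ⟨f (γ 0) - c * t, by rintro _ ⟨y, rfl⟩; exact hle y⟩ (γ (-t))
  have : Nonempty Γ.Point := ⟨γ 0⟩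
  have h4 : f (γ 0) - c * t ≤ L.lax t f (γ 0) := le_ciInf hle
  linarith

end CriticalSolution

end GraphLagrangian

theorem mainTheorem4 {V E : Type*} [Finite V] [Finite E] (Γ : MetricGraph V E)
    (L : GraphLagrangian Γ) (hL : L.SymmetricAtVertices) (f : Γ.Point → ℝ)
    (hf : L.IsViscositySolution L.criticalValue f) :
    (∀ t > 0, ∀ x, L.lax t f x + L.criticalValue * t = f x) ∧
      L.IsBackwardWeakKAM L.criticalValue f := by
  obtain ⟨a, b, w, z, h⟩ := hf.exists_criticalSolution
  exact ⟨fun t ht x => h.lax_add ht x, h.isBackwardWeakKAM⟩
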